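/- Let $k$ be an algebraically closed field of characteristic $\neq 2$ and let $n\ge 1$. An automorphism $\sigma$ of the algebraic group $\mathrm{GL}_n(k)$ with $\sigma^2=1$ (the case $\sigma=\mathrm{id}$ is allowed, and counts as inner) defines an algebraic group $\mathrm{GL}_n(k)\rtimes\langle\sigma\rangle=\mathrm{GL}_n(k)\rtimes\mathbb{Z}/2\mathbb{Z}$ in which $1\in\mathbb{Z}/2\mathbb{Z}$ acts on $\mathrm{GL}_n(k)$ by $\sigma$. Call $\sigma$ inner if it is conjugation by an element of $\mathrm{GL}_n(k)$, and outer otherwise. Let $J_0=(\delta_{i,n+1-j})_{i,j}$ and $\sigma_o(g)=J_0\,{}^{t}g^{-1}J_0^{-1}$; for even $n$ let also $t=\mathrm{diag}(1,\dots,1,-1,\dots,-1)$ with $n/2$ entries $1$ followed by $n/2$ entries $-1$, $J=tJ_0$ and $\sigma_s(g)=J\,{}^{t}g^{-1}J^{-1}$. An outer $\sigma$ is of orthogonal type (resp., for even $n$, of symplectic type) if $\sigma=\mathrm{ad}(y)\,\sigma_o\,\mathrm{ad}(y)^{-1}$ (resp. $\sigma=\mathrm{ad}(y)\,\sigma_s\,\mathrm{ad}(y)^{-1}$)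 for some $y\in\mathrm{GL}_n(k)$, where $\mathrm{ad}(y)$ denotes conjugation by $y$. Consider the equivalence relation on the set of all such $\sigma$ under which $\sigma_1$ and $\sigma_2$ are equivalent if $\mathrm{GL}_n(k)\rtimes\langle\sigma_1\rangle$ and $\mathrm{GL}_n(k)\rtimes\langle\sigma_2\rangle$ are isomorphic as algebraic groups. Then: (1) If $\sigma$ is inner, then $\mathrm{GL}_n(k)\rtimes\langle\sigma\rangle$ is isomorphic, as an algebraic group, to the direct product $\mathrm{GL}_n(k)\times\mathbb{Z}/2\mathbb{Z}$. (2) If $n$ is even, there are exactly three equivalence classes: the set of all inner $\sigma$, the set of all outer $\sigma$ of symplectic type, and the set of all outer $\sigma$ of orthogonal type. (3) If $n$ is odd, there are exactly two equivalence classes: the set of all inner $\sigma$ and the set of all outer $\sigma$. -/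

import Mathlib

namespace GLSemidirect

/-- The group `GL_n(k)`. -/
abbrev G (k : Type*) [Field k] (n : ℕ) : Type _ := Matrix.GeneralLinearGroup (Fin n) k

/-- The cyclic group `ℤ/2ℤ`, written multiplicatively. -/
abbrev C2 : Type := Multiplicative (ZMod 2)

/-- A bijection `e` between two sets of closed points of affine varieties, with rings of regular
functions `A` and `B`, is an isomorphism of varieties: composition with `e` identifies `B`
with `A`. -/
def IsVarietyIso {k X Y : Type*} [Field k] (A : Subalgebra k (X → k)) (B : Subalgebra k (Y → k))
    (e : X ≃ Y) : Prop :=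
  ∀ f : Y → k, f ∈ B ↔ f ∘ e ∈ A

/-- The ring of regular functions on `GL_n(k)`: the algebra of functions generated by the matrix
entries and the inverse of the determinant. -/
def regGL (k : Type*) [Field k] (n : ℕ) : Subalgebra k (G k n → k) :=
  Algebra.adjoin k
    (Set.range (fun (p : Fin n × Fin n) (g : G k n) => (g : Matrix (Fin n) (Fin n) k) p.1 p.2) ∪
      {fun g : G k n => ((g : Matrix (Fin n) (Fin n) k).det)⁻¹})

/-- An automorphism `σ` of the algebraic group `GL_n(k)` with `σ² = 1` (`σ = 1` is allowed). -/
structure Involution (k : Type*) [Field k] (n : ℕ) where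
  aut : MulAut (G k n)
  algebraic : IsVarietyIso (regGL k n) (regGL k n) aut.toEquiv
  sq : aut * aut = 1

namespace Involution

variable {k : Type*} [Field k] {n : ℕ}

/-- The action of `ℤ/2ℤ` on `GL_n(k)` in which the generator acts by `σ`. -/
def action (σ : Involution k n) : C2 →* MulAut (G k n) where
  toFun s := if s = 1 then 1 else σ.aut
  map_one' := by simp
  map_mul' := by
    have key : ∀ s : C2, s = 1 ∨ s = Multiplicative.ofAdd 1 := by decide
    have h1 : (Multiplicative.ofAdd 1 : C2) ≠ 1 := by decide
    have h2 : (Multiplicative.ofAdd 1 : C2) * Multiplicative.ofAdd 1 = 1 := by decide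
    intro s t
    rcases key s with rfl | rfl <;> rcases key t with rfl | rfl <;> simp [h1, h2, σ.sq]

theorem action_generator (σ : Involution k n) : σ.action (Multiplicative.ofAdd 1) = σ.aut := by
  have h1 : (Multiplicative.ofAdd 1 : C2) ≠ 1 := by decide
  simp [action, h1]

/-- The semidirect product `GL_n(k) ⋊ ⟨σ⟩`. -/
abbrev Semidirect (σ : Involution k n) : Type _ := G k n ⋊[σ.action] C2

/-- The ring of regular functions on `GL_n(k) ⋊ ⟨σ⟩`, which as a variety is the disjoint union of
the two cosets `GL_n(k) × {s}`. -/
def reg (σ : Involution k n) : Subalgebra k (σ.Semidirect → k) where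
  carrier := {f | ∀ s : C2, (fun g : G k n => f ⟨g, s⟩) ∈ regGL k n}
  mul_mem' ha hb s := (regGL k n).mul_mem (ha s) (hb s)
  add_mem' ha hb s := (regGL k n).add_mem (ha s) (hb s)
  algebraMap_mem' r _ := (regGL k n).algebraMap_mem r

/-- `GL_n(k) ⋊ ⟨σ⟩` and `GL_n(k) ⋊ ⟨σ'⟩` are isomorphic algebraic groups. -/
def Iso (σ σ' : Involution k n) : Prop :=
  ∃ e : σ.Semidirect ≃* σ'.Semidirect, IsVarietyIso σ.reg σ'.reg e.toEquiv

/-- `σ` is an inner automorphism. -/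
def IsInner (σ : Involution k n) : Prop :=
  ∃ x : G k n, σ.aut = MulAut.conj x

/-- `σ` is an outer automorphism, that is, not inner. -/
def IsOuter (σ : Involution k n) : Prop := ¬ σ.IsInner

end Involution

/-- The ring of regular functions on the direct product `GL_n(k) × ℤ/2ℤ`. -/
def regProd (k : Type*) [Field k] (n : ℕ) : Subalgebra k (G k n × C2 → k) where
  carrier := {f | ∀ s : C2, (fun g : G k n => f (g, s)) ∈ regGL k n}
  mul_mem' ha hb s := (regGL k n).mul_mem (ha s) (hb s)
  add_mem' ha hb s := (regGL k n).add_mem (ha s) (hb s)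
  algebraMap_mem' r _ := (regGL k n).algebraMap_mem r

/-- The equivalence relation on involutions `σ`: the algebraic groups `GL_n(k) ⋊ ⟨σ⟩` are
isomorphic. Its classes are the isomorphism classes of semidirect products. -/
def isoSetoid (k : Type*) [Field k] (n : ℕ) : Setoid (Involution k n) where
  r := Involution.Iso
  iseqv :=
    { refl := fun _ => ⟨MulEquiv.refl _, fun _ => Iff.rfl⟩
      symm := by
        rintro σ σ' ⟨e, he⟩
        refine ⟨e.symm, fun f => ?_⟩
        have h := he (f ∘ e.symm)
        have hf : (f ∘ e.symm) ∘ e.toEquiv = f := by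
          funext x
          simp
        rw [hf] at h
        exact h.symm
      trans := by
        rintro σ σ' σ'' ⟨e, he⟩ ⟨e', he'⟩
        exact ⟨e.trans e', fun f => (he' f).trans (he _)⟩ }

/-- The automorphism `g ↦ ᵗg⁻¹` of `GL_n(k)`. -/
def transposeInverse (k : Type*) [Field k] (n : ℕ) : MulAut (G k n) where
  toFun g :=
    { val := (g⁻¹ : G k n).val.transpose
      inv := g.val.transpose
      val_inv := by rw [← Matrix.transpose_mul, Units.mul_inv, Matrix.transpose_one]
      inv_val := by rw [← Matrix.transpose_mul, Units.inv_mul, Matrix.transpose_one] }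
  invFun g :=
    { val := (g⁻¹ : G k n).val.transpose
      inv := g.val.transpose
      val_inv := by rw [← Matrix.transpose_mul, Units.mul_inv, Matrix.transpose_one]
      inv_val := by rw [← Matrix.transpose_mul, Units.inv_mul, Matrix.transpose_one] }
  left_inv g := by
    apply Units.ext
    exact Matrix.transpose_transpose _
  right_inv g := by
    apply Units.ext
    exact Matrix.transpose_transpose _
  map_mul' g h := by
    apply Units.ext
    change ((g * h)⁻¹ : G k n).val.transpose = (g⁻¹ : G k n).val.transpose * (h⁻¹ : G k n).val.transpose
    rw [mul_inv_rev, Units.val_mul, Matrix.transpose_mul]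

/-- The antidiagonal permutation matrix `J₀`. -/
def J0Matrix (k : Type*) [Field k] (n : ℕ) : Matrix (Fin n) (Fin n) k :=
  Matrix.of fun i j => if j = Fin.rev i then 1 else 0

/-- The diagonal matrix `diag(1, …, 1, -1, …, -1)`, with equally many `1` and `-1` for even `n`. -/
def tMatrix (k : Type*) [Field k] (n : ℕ) : Matrix (Fin n) (Fin n) k :=
  Matrix.diagonal fun i => if (i : ℕ) < n / 2 then 1 else -1

theorem J0Matrix_mul_self (k : Type*) [Field k] (n : ℕ) : J0Matrix k n * J0Matrix k n = 1 := by
  ext i j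
  have h : ∀ x : Fin n, (j = x.rev) = (x = j.rev) := fun x =>
    propext ⟨fun h => by rw [h, Fin.rev_rev], fun h => by rw [h, Fin.rev_rev]⟩
  simp [J0Matrix, Matrix.mul_apply, Matrix.one_apply, h, Fin.rev_inj, @eq_comm _ j i]

theorem tMatrix_mul_self (k : Type*) [Field k] (n : ℕ) : tMatrix k n * tMatrix k n = 1 := by
  rw [tMatrix, Matrix.diagonal_mul_diagonal, ← Matrix.diagonal_one]
  congr 1
  funext i
  split_ifs <;> simp

/-- `J₀` as an element of `GL_n(k)`. -/
def J0 (k : Type*) [Field k] (n : ℕ) : G k n :=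
  ⟨J0Matrix k n, J0Matrix k n, J0Matrix_mul_self k n, J0Matrix_mul_self k n⟩

/-- `t` as an element of `GL_n(k)`. -/
def t (k : Type*) [Field k] (n : ℕ) : G k n :=
  ⟨tMatrix k n, tMatrix k n, tMatrix_mul_self k n, tMatrix_mul_self k n⟩

/-- `J = t J₀`; an alternating matrix if `n` is even. -/
def J (k : Type*) [Field k] (n : ℕ) : G k n := t k n * J0 k n

/-- `σ_o : g ↦ J₀ ᵗg⁻¹ J₀⁻¹`. -/
def sigmaO (k : Type*) [Field k] (n : ℕ) : MulAut (G k n) :=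
  MulAut.conj (J0 k n) * transposeInverse k n

/-- `σ_s : g ↦ J ᵗg⁻¹ J⁻¹` (used for even `n` only). -/
def sigmaS (k : Type*) [Field k] (n : ℕ) : MulAut (G k n) :=
  MulAut.conj (J k n) * transposeInverse k n

namespace Involution

variable {k : Type*} [Field k] {n : ℕ}

/-- `σ` is conjugate under `GL_n(k)` to `σ_o`. -/
def IsOrthogonalType (σ : Involution k n) : Prop :=
  ∃ y : G k n, σ.aut = MulAut.conj y * sigmaO k n * (MulAut.conj y)⁻¹

/-- `σ` is conjugate under `GL_n(k)` to `σ_s` (used for even `n` only). -/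
def IsSymplecticType (σ : Involution k n) : Prop :=
  ∃ y : G k n, σ.aut = MulAut.conj y * sigmaS k n * (MulAut.conj y)⁻¹

end Involution

end GLSemidirect

/-! Since `GL_n` is connected, an isomorphism of two semidirect products preserves the identity
component. It therefore yields an algebraic automorphism `φ` and an element `x` with `φ σ φ⁻¹ =
ad(x) σ'` and `x σ'(x) = 1` (`exists_aut_of_iso`); in particular inner and outer involutions never
mix. If `σ` is inner, it is `ad(x)` for some `x` scaled so that `x² = 1`, and `(g, s) ↦ (g xˢ, s)`
untwists the product.

An algebraic automorphism is inner, or inner times the transpose inverse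
(`IsRegularAut.exists_eq_conj`). So an outer `σ` is `g ↦ a ᵗg⁻¹ a⁻¹`, and `σ² = 1` forces `ᵗa = ε a`
with `ε = ±1`. Forms of equal sign are congruent, because an invertible matrix has a square root
that is a polynomial in it; hence `ε` determines the class. Conversely `x σ'(x) = 1` makes `ε` an
invariant (`HasSign.eq_of_iso`). For odd `n`, determinants exclude `ε = -1`.

The classification of automorphisms uses no root systems. The images of the diagonal sign matrices
are simultaneously diagonalizable, and counting conjugacy classes shows that, up to an inner
automorphism, reflections go to reflections up to sign. The diagonal torus is then stable and the
action on it is given by two integer exponents. After a possible transpose inverse, traces are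
preserved on the torus, hence everywhere by density of diagonalizable matrices. A trace preserving
automorphism extends linearly to the matrix algebra and is inner by Skolem–Noether. -/

namespace GLSemidirect
open Polynomial Matrix

/-! ### Polynomial square roots and congruence of bilinear forms -/

theorem transpose_aeval_mul {k : Type*} [Field k] {n : ℕ} {A M : Matrix (Fin n) (Fin n) k}
    (h : Mᵀ * A = A * M) (p : k[X]) : (aeval M p)ᵀ * A = A * aeval M p := by
  induction p using Polynomial.induction_on' with
  | add p q hp hq => rw [map_add, transpose_add, add_mul, mul_add, hp, hq]
  | monomial m a =>
    have : (M ^ m)ᵀ * A = A * M ^ m := by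
      induction m with
      | zero => simp
      | succ m ih => rw [pow_succ', transpose_mul, mul_assoc, h, ← mul_assoc, ih, mul_assoc,
        ← pow_succ, ← pow_succ']
    simp only [aeval_monomial, Algebra.algebraMap_eq_smul_one, smul_mul_assoc, one_mul,
      transpose_smul, this, mul_smul_comm]

section SquareRoot

variable {k : Type*} [Field k] [IsAlgClosed k]

/-- Each linear factor of `p` divides `h`, so their product divides a power of `h`. Modulo `p`, this
makes `h` nilpotent. -/
theorem exists_dvd_pow_of_eval_roots_eq_zero {p h : k[X]} (hp : p.Monic)
    (H : ∀ a ∈ p.roots, h.eval a = 0) : ∃ m, p ∣ h ^ m := by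
  refine ⟨Multiset.card p.roots, ?_⟩
  have h1 := Multiset.prod_dvd_prod_of_dvd (S := p.roots) (fun a => X - C a) (fun _ => h)
    fun a ha => dvd_iff_isRoot.2 (H a ha)
  rwa [← (IsAlgClosed.splits p).eq_prod_roots_of_monic hp, Multiset.map_const',
    Multiset.prod_replicate] at h1

/-- An invertible matrix over an algebraically closed field of characteristic `≠ 2` has a square
root that is a polynomial in it. -/
theorem exists_aeval_mul_self_eq (hk : (2 : k) ≠ 0) {n : ℕ} (M : Matrix (Fin n) (Fin n) k)
    (hM : M.det ≠ 0) : ∃ p : k[X], aeval M p * aeval M p = M := by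
  classical
  set χ := M.charpoly with hχ
  choose r hr using fun a : k => IsAlgClosed.exists_pow_nat_eq a (n := 2) (by norm_num)
  -- `q` takes the value `√a` at each eigenvalue `a`. It is a square root of `X` modulo `χ` up to a
  -- nilpotent error, the starting point for Newton's method.
  set q : k[X] := Lagrange.interpolate χ.roots.toFinset id r with hq
  have hqe : ∀ a ∈ χ.roots, q.eval a = r a := fun a ha =>
    Lagrange.eval_interpolate_at_node (v := id) r (Set.injOn_id _) (Multiset.mem_toFinset.2 ha)
  have hmon : χ.Monic := M.charpoly_monic
  have h0 : ∀ a ∈ χ.roots, a ≠ 0 := by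
    rintro a ha rfl
    have h := (mem_roots'.1 ha).2
    rw [IsRoot.def, hχ, ← coeff_zero_eq_eval_zero] at h
    apply hM
    rw [det_eq_sign_charpoly_coeff, h, mul_zero]
  obtain ⟨m, hm⟩ := exists_dvd_pow_of_eval_roots_eq_zero (h := q ^ 2 - X) hmon (fun a ha => by
    rw [eval_sub, eval_pow, hqe a ha, hr, eval_X, sub_self])
  -- The derivative `2q` of `Y² - X` at `q` must be a unit modulo `χ`: the eigenvalues are nonzero,
  -- so `q` and `χ` have no common root.
  have hcop : IsCoprime q χ := by
    rw [isCoprime_iff_aeval_ne_zero_of_isAlgClosed k k]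
    intro a
    by_contra! hc
    have ha : a ∈ χ.roots := mem_roots'.2 ⟨hmon.ne_zero, by simpa using hc.2⟩
    have h1 := hr a
    rw [← hqe a ha, show q.eval a = 0 by simpa using hc.1] at h1
    exact h0 a ha (by simpa using h1.symm)
  set P : (AdjoinRoot χ)[X] := X ^ 2 - C (AdjoinRoot.root χ) with hP
  have hnil : IsNilpotent (aeval (AdjoinRoot.mk χ q) P) := by
    refine ⟨m, ?_⟩
    have : aeval (AdjoinRoot.mk χ q) P = AdjoinRoot.mk χ (q ^ 2 - X) := by
      simp [hP]
    rw [this, ← map_pow, AdjoinRoot.mk_eq_zero]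
    exact hm
  have hu : IsUnit (aeval (AdjoinRoot.mk χ q) (derivative P)) := by
    obtain ⟨u, v, huv⟩ := hcop
    have h1 : AdjoinRoot.mk χ u * AdjoinRoot.mk χ q = 1 := by
      have := congrArg (AdjoinRoot.mk χ) huv
      simpa using this
    have h2 : aeval (AdjoinRoot.mk χ q) (derivative P) = AdjoinRoot.mk χ (C 2 * q) := by
      simp [hP, one_add_one_eq_two, map_ofNat]
    rw [h2]
    refine IsUnit.of_mul_eq_one (AdjoinRoot.mk χ (C 2⁻¹ * u)) ?_
    rw [← map_mul, show C 2 * q * (C 2⁻¹ * u) = (C (2 * 2⁻¹)) * (u * q) by rw [C_mul]; ring,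
      mul_inv_cancel₀ hk, C_1, one_mul, map_mul, h1]
  -- Newton–Hensel lifting corrects `q` by a nilpotent to an exact root; Cayley–Hamilton then
  -- transfers the identity to `M`.
  obtain ⟨s, ⟨-, hs⟩, -⟩ := existsUnique_nilpotent_sub_and_aeval_eq_zero hnil hu
  obtain ⟨p, rfl⟩ := AdjoinRoot.mk_surjective s
  have h3 : AdjoinRoot.mk χ (p * p - X) = 0 := by
    rw [← hs]; simp [hP, sq]
  rw [AdjoinRoot.mk_eq_zero] at h3
  refine ⟨p, ?_⟩
  obtain ⟨w, hw⟩ := h3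
  have h4 := congrArg (aeval M) hw
  rw [map_mul, hχ, aeval_self_charpoly, zero_mul, map_sub, map_mul, aeval_X, sub_eq_zero] at h4
  exact h4

/-- Two nondegenerate bilinear forms that are both symmetric or both alternating are congruent. -/
theorem exists_mul_mul_transpose_eq (hk : (2 : k) ≠ 0) {n : ℕ} {ε : k} (hε : ε ≠ 0) (a b : G k n)
    (ha : a.valᵀ = ε • a.val) (hb : b.valᵀ = ε • b.val) :
    ∃ y : G k n, y.val * a.val * y.valᵀ = b.val := by
  set M := (a⁻¹ * b).val with hM
  have hAM : a.val * M = b.val := by rw [hM, ← Units.val_mul, mul_inv_cancel_left]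
  have hMA : M.transpose * a.val = a.val * M := by
    have h1 := congrArg transpose hAM
    rw [transpose_mul, ha, hb, mul_smul_comm] at h1
    rw [hAM]
    exact smul_right_injective _ hε h1
  obtain ⟨p, hp⟩ := exists_aeval_mul_self_eq hk M (GeneralLinearGroup.det_ne_zero _)
  have hdet : (aeval M p).det ≠ 0 := fun h0 => by
    have h1 := congrArg det hp
    rw [det_mul, h0, zero_mul] at h1
    exact GeneralLinearGroup.det_ne_zero (a⁻¹ * b) h1.symm
  -- With `y = ᵗp(M)`, the product `y a ᵗy` equals `a p(M)² = a M = b`, because `a` intertwines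
  -- `p(M)` with its transpose.
  refine ⟨GeneralLinearGroup.mkOfDetNeZero (aeval M p)ᵀ (by rwa [det_transpose]), ?_⟩
  change (aeval M p)ᵀ * a.val * (aeval M p)ᵀᵀ = b.val
  rw [transpose_transpose, transpose_aeval_mul hMA, mul_assoc, hp, hAM]

end SquareRoot

/-! ### Regular functions along curves and connectedness of `GL_n` -/

section RegularFunctions

variable {k : Type*} [Field k] {n : ℕ}

/-- Along a polynomial curve of matrices a regular function on `GL_n` is a polynomial divided by a
power of the determinant. -/
theorem exists_eval_of_mem_regGL {f : G k n → k} (hf : f ∈ regGL k n)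
    (M : Matrix (Fin n) (Fin n) k[X]) :
    ∃ (N : ℕ) (P : k[X]), ∀ (x : k) (g : G k n), g.val = M.map (eval x) →
      f g * g.val.det ^ N = P.eval x := by
  have hdet : ∀ (x : k) (g : G k n), g.val = M.map (eval x) → g.val.det = M.det.eval x := by
    intro x g hg
    rw [hg]
    exact ((evalRingHom x).map_det M).symm
  induction hf using Algebra.adjoin_induction with
  | mem f hf =>
    rcases hf with ⟨p, rfl⟩ | rfl
    · exact ⟨0, M p.1 p.2, fun x g hg => by simp [hg]⟩
    · exact ⟨1, 1, fun x g hg => by simp [GeneralLinearGroup.det_ne_zero g]⟩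
  | algebraMap r => exact ⟨0, C r, fun x g hg => by simp⟩
  | add f₁ f₂ _ _ h₁ h₂ =>
    obtain ⟨N₁, P₁, h₁⟩ := h₁
    obtain ⟨N₂, P₂, h₂⟩ := h₂
    refine ⟨N₁ + N₂, P₁ * M.det ^ N₂ + P₂ * M.det ^ N₁, fun x g hg => ?_⟩
    simp only [eval_add, eval_mul, eval_pow, ← h₁ x g hg, ← h₂ x g hg, ← hdet x g hg, Pi.add_apply]
    ring
  | mul f₁ f₂ _ _ h₁ h₂ =>
    obtain ⟨N₁, P₁, h₁⟩ := h₁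
    obtain ⟨N₂, P₂, h₂⟩ := h₂
    refine ⟨N₁ + N₂, P₁ * P₂, fun x g hg => ?_⟩
    simp only [eval_mul, ← h₁ x g hg, ← h₂ x g hg, Pi.mul_apply]
    ring

/-- A regular function that vanishes at almost all invertible points of a polynomial curve vanishes
at all of them. -/
theorem eq_zero_of_eq_zero_on_curve [Infinite k] {f : G k n → k} (hf : f ∈ regGL k n)
    (M : Matrix (Fin n) (Fin n) k[X]) {R : k[X]} (hR : R ≠ 0)
    (h : ∀ (x : k) (g : G k n), R.eval x ≠ 0 → g.val = M.map (eval x) → f g = 0)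
    (x₀ : k) (g₀ : G k n) (hg₀ : g₀.val = M.map (eval x₀)) : f g₀ = 0 := by
  obtain ⟨N, P, hP⟩ := exists_eval_of_mem_regGL hf M
  have hdet : ∀ x : k, (M.map (eval x)).det = M.det.eval x := fun x =>
    ((evalRingHom x).map_det M).symm
  have hD : M.det ≠ 0 := fun h0 => by
    have := GeneralLinearGroup.det_ne_zero g₀
    rw [hg₀, hdet, h0, eval_zero] at this
    exact this rfl
  have hz : P * (R * M.det) = 0 := by
    refine Polynomial.funext fun x => ?_
    rw [eval_zero, eval_mul, eval_mul]
    by_cases hx : R.eval x = 0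
    · simp [hx]
    by_cases hd : M.det.eval x = 0
    · simp [hd]
    have hg : (GeneralLinearGroup.mkOfDetNeZero (M.map (eval x)) (by rwa [hdet])).val =
      M.map (eval x) := rfl
    rw [← hP x _ hg, h x _ hx hg]
    simp
  have hP0 : P = 0 := (mul_eq_zero.1 hz).resolve_right (mul_ne_zero hR hD)
  have := hP x₀ g₀ hg₀
  rw [hP0, eval_zero] at this
  exact (mul_eq_zero.1 this).resolve_right (pow_ne_zero _ (GeneralLinearGroup.det_ne_zero g₀))

/-- The polynomial matrix of the line through `A` (at `0`) and `B` (at `1`). -/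
noncomputable def lineMatrix (A B : Matrix (Fin n) (Fin n) k) : Matrix (Fin n) (Fin n) k[X] :=
  Matrix.of fun i j => C (A i j) * (1 - X) + C (B i j) * X

theorem lineMatrix_map_eval_zero (A B : Matrix (Fin n) (Fin n) k) :
    (lineMatrix A B).map (eval 0) = A := by
  ext i j; simp [lineMatrix]

theorem lineMatrix_map_eval_one (A B : Matrix (Fin n) (Fin n) k) :
    (lineMatrix A B).map (eval 1) = B := by
  ext i j; simp [lineMatrix]

/-- `GL_n` is connected: an idempotent regular function that is `1` at the identity is `1`. -/
theorem eq_one_of_idempotent [Infinite k] {f : G k n → k} (hf : f ∈ regGL k n)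
    (hidem : ∀ g, f g = 0 ∨ f g = 1) (h1 : f 1 = 1) (g : G k n) : f g = 1 := by
  by_contra hg
  have hg0 : f g = 0 := (hidem g).resolve_right hg
  obtain ⟨N, P, hP⟩ := exists_eval_of_mem_regGL hf (lineMatrix g.val (1 : G k n).val)
  have h1' := hP 1 1 (lineMatrix_map_eval_one _ _).symm
  -- On the line from `g` to `1`, `P` is `f` times a power of the determinant. It is nonzero at `1`,
  -- and wherever it is nonzero `f` must be `1`; this propagates to `g`.
  have hPne : P ≠ 0 := by
    rintro rfl
    simp [h1] at h1'
  have hz : f g - 1 = 0 := by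
    refine eq_zero_of_eq_zero_on_curve (sub_mem hf (one_mem _))
      (lineMatrix g.val (1 : G k n).val) hPne (fun x y hx hy => ?_) 0 g
      (lineMatrix_map_eval_zero _ _).symm
    rw [← hP x y hy] at hx
    have := (hidem y).resolve_left (left_ne_zero_of_mul hx)
    simp [this]
  simp [hg0] at hz

theorem entry_mem_regGL (i j : Fin n) : (fun g : G k n => g.val i j) ∈ regGL k n :=
  Algebra.subset_adjoin (Or.inl ⟨(i, j), rfl⟩)

theorem inv_det_mem_regGL : (fun g : G k n => g.val.det⁻¹) ∈ regGL k n :=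
  Algebra.subset_adjoin (Or.inr rfl)

theorem trace_mem_regGL : (fun g : G k n => g.val.trace) ∈ regGL k n := by
  have : (fun g : G k n => g.val.trace) = ∑ i, fun g : G k n => g.val i i := by
    funext g; simp [Matrix.trace]
  rw [this]
  exact sum_mem fun i _ => entry_mem_regGL i i

end RegularFunctions

/-! ### Density of diagonalizable matrices -/

section Diagonalization

variable {k : Type*} [Field k] {n : ℕ}

theorem exists_mul_eq_mul_diagonal {v : Fin n → Fin n → k} (hv : LinearIndependent k v) :
    ∃ y : G k n, ∀ (A : Matrix (Fin n) (Fin n) k) (d : Fin n → k),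
      (∀ i, A *ᵥ v i = d i • v i) → A * y.val = y.val * diagonal d := by
  have hu : IsUnit (Matrix.of v)ᵀ := by
    rw [← linearIndependent_cols_iff_isUnit]
    exact hv
  obtain ⟨y, hy⟩ := hu
  refine ⟨y, fun A d h => ?_⟩
  rw [hy]
  ext i j
  have := congrFun (h j) i
  rw [mul_diagonal]
  simpa [mul_apply, mulVec, dotProduct, mul_comm] using this

variable [IsAlgClosed k]

theorem exists_diagonal_of_separable_charpoly {A : Matrix (Fin n) (Fin n) k}
    (hA : A.charpoly.Separable) :
    ∃ (y : G k n) (d : Fin n → k), A * y.val = y.val * diagonal d := by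
  classical
  have hcard : A.charpoly.roots.toFinset.card = n := by
    rw [Multiset.toFinset_card_of_nodup (nodup_roots hA),
      ← (IsAlgClosed.splits A.charpoly).natDegree_eq_card_roots, charpoly_natDegree_eq_dim,
      Fintype.card_fin]
  let e := (Finset.equivFinOfCardEq hcard).symm
  have hev : ∀ i, ∃ v : Fin n → k, Module.End.HasEigenvector (toLin' A) (e i : k) v := by
    intro i
    apply Module.End.HasEigenvalue.exists_hasEigenvector
    rw [Module.End.hasEigenvalue_iff_isRoot_charpoly, charpoly_toLin']
    exact (mem_roots'.1 (Multiset.mem_toFinset.1 (e i).2)).2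
  choose v hv using hev
  have hli := Module.End.eigenvectors_linearIndependent' (toLin' A) (fun i => (e i : k))
    (Subtype.val_injective.comp e.injective) v hv
  obtain ⟨y, hy⟩ := exists_mul_eq_mul_diagonal hli
  refine ⟨y, fun i => e i, hy _ _ fun i => ?_⟩
  simpa using (hv i).apply_eq_smul

/-- Diagonalizable matrices are dense in `GL_n`. -/
theorem eq_zero_of_eq_zero_of_diagonalizable {f : G k n → k} (hf : f ∈ regGL k n)
    (h : ∀ (g y : G k n) (d : Fin n → k), g.val * y.val = y.val * diagonal d → f g = 0)
    (g : G k n) : f g = 0 := by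
  have : Infinite k := IsAlgClosed.instInfinite
  -- The line from `g` to a diagonal matrix with distinct entries has a discriminant that is nonzero
  -- at the far end, so almost all of its points have separable characteristic polynomial.
  let d : Fin n → k := fun i => Infinite.natEmbedding k i
  have hd : Function.Injective d := fun i j hij => Fin.ext ((Infinite.natEmbedding k).injective hij)
  set M := lineMatrix g.val (diagonal d) with hM
  set χ := M.charpoly with hχ
  have hmap : ∀ x : k, (M.map (eval x)).charpoly = χ.map (evalRingHom x) := fun x =>
    charpoly_map M (evalRingHom x)
  have hsep : ∀ x : k, (χ.resultant χ.derivative).eval x ≠ 0 ↔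
      (M.map (eval x)).charpoly.Separable := by
    intro x
    rw [hmap, Polynomial.Separable, ← isUnit_resultant_iff_isCoprime (M.charpoly_monic.map _),
      isUnit_iff_ne_zero, derivative_map, ← coe_evalRingHom, ← resultant_map_map,
      M.charpoly_monic.natDegree_map]
    -- Specialization may lower the degree of the derivative. This changes the resultant only by a
    -- power of the leading coefficient of `χ`, which is `1`.
    have hle : (χ.derivative.map (evalRingHom x)).natDegree ≤ χ.derivative.natDegree :=
      natDegree_map_le
    obtain ⟨m, hm⟩ := Nat.exists_eq_add_of_le hle
    rw [hm, resultant_add_right_deg _ _ _ _ _ le_rfl]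
    have : (χ.map (evalRingHom x)).coeff χ.natDegree = 1 := by
      rw [coeff_map, hχ, M.charpoly_monic.coeff_natDegree, map_one]
    rw [this, one_pow, one_mul]
  have hR : χ.resultant χ.derivative ≠ 0 := by
    have h1 := (hsep 1).2 (by
      rw [hM, lineMatrix_map_eval_one, charpoly_diagonal]
      exact separable_prod_X_sub_C_iff.2 hd)
    rintro h0
    simp [h0] at h1
  refine eq_zero_of_eq_zero_on_curve hf M hR (fun x y hx hy => ?_) 0 g
    (lineMatrix_map_eval_zero _ _).symm
  rw [hsep, ← hy] at hx
  obtain ⟨z, d, hz⟩ := exists_diagonal_of_separable_charpoly hx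
  exact h y z d hz

end Diagonalization

/-! ### Trace preserving automorphisms are inner -/

section TracePreserving

variable {k : Type*} [Field k] {n : ℕ}

/-- Together with `1`, these invertible matrices span the matrix algebra. The diagonal case needs
`2` to be invertible. -/
theorem exists_val_eq_one_add_single (hk : (2 : k) ≠ 0) (i j : Fin n) :
    ∃ g : G k n, g.val = 1 + single i j 1 := by
  rcases eq_or_ne i j with rfl | h
  · have h1 : (1 + single i i (1 : k)) * (1 - single i i 2⁻¹) = (1 : Matrix (Fin n) (Fin n) k) := by
      simp only [add_mul, mul_sub, one_mul, mul_one, single_mul_single_same]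
      rw [← single_add, add_sub_assoc, add_eq_left, sub_eq_zero]
      congr 1
      field_simp
      norm_num
    exact ⟨⟨_, _, h1, mul_eq_one_comm.1 h1⟩, rfl⟩
  · have h1 : (1 + single i j (1 : k)) * (1 - single i j 1) = (1 : Matrix (Fin n) (Fin n) k) := by
      simp [add_mul, mul_sub, single_mul_single_of_ne, h.symm]
    exact ⟨⟨_, _, h1, mul_eq_one_comm.1 h1⟩, rfl⟩

theorem linearMap_ext_of_eq_on_GL (hk : (2 : k) ≠ 0) {W : Type*} [AddCommGroup W] [Module k W]
    {F F' : Matrix (Fin n) (Fin n) k →ₗ[k] W} (h : ∀ g : G k n, F g.val = F' g.val) : F = F' := by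
  refine Matrix.ext_linearMap k fun i j => LinearMap.ext_ring ?_
  obtain ⟨g, hg⟩ := exists_val_eq_one_add_single hk i j
  have h1 := h g
  have h2 := h 1
  rw [hg, map_add, map_add, ← Units.val_one, h2] at h1
  simpa using h1

/-- The linear map `E_ij ↦ φ(1 + E_ij) - 1` extending a trace preserving automorphism. -/
theorem exists_algEquiv_of_trace_eq (hk : (2 : k) ≠ 0) (φ : MulAut (G k n))
    (hφ : ∀ g, (φ g).val.trace = g.val.trace) :
    ∃ L : Matrix (Fin n) (Fin n) k ≃ₐ[k] Matrix (Fin n) (Fin n) k,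
      ∀ g : G k n, L g.val = (φ g).val := by
  choose e he using exists_val_eq_one_add_single (n := n) hk
  let L : Matrix (Fin n) (Fin n) k →ₗ[k] Matrix (Fin n) (Fin n) k :=
    { toFun := fun A => ∑ i, ∑ j, A i j • ((φ (e i j)).val - 1)
      map_add' := fun A B => by simp [add_smul, Finset.sum_add_distrib]
      map_smul' := fun c A => by simp [Finset.smul_sum, mul_smul] }
  -- `L` carries the trace pairing against `h` to the pairing against `φ h`. Nondegeneracy of the
  -- pairing will then determine `L` on `GL_n` and give injectivity.
  have htr : ∀ (h : G k n) A, (L A * (φ h).val).trace = (A * h.val).trace := by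
    intro h A
    have h1 : ∀ i j, (((φ (e i j)).val - 1) * (φ h).val).trace = h.val j i := by
      intro i j
      rw [sub_mul, one_mul, ← Units.val_mul, ← map_mul, trace_sub, hφ, hφ, Units.val_mul, he,
        add_mul, one_mul, trace_add, add_sub_cancel_left, trace_single_mul, one_smul]
    simp only [L, LinearMap.coe_mk, AddHom.coe_mk, Finset.sum_mul, trace_sum, smul_mul_assoc,
      trace_smul, h1]
    simp [Matrix.trace, mul_apply]
  have hzero : ∀ A : Matrix (Fin n) (Fin n) k, (∀ h : G k n, (A * h.val).trace = 0) → A = 0 := by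
    intro A hA
    rw [ext_iff_trace_mul_right]
    intro B
    let F : Matrix (Fin n) (Fin n) k →ₗ[k] k := traceLinearMap _ _ _ ∘ₗ LinearMap.mulLeft k A
    have : F = 0 := linearMap_ext_of_eq_on_GL hk fun g => hA g
    rw [zero_mul, trace_zero]
    exact LinearMap.congr_fun this B
  have hL : ∀ g : G k n, L g.val = (φ g).val := by
    intro g
    rw [← sub_eq_zero]
    refine hzero _ fun h => ?_
    obtain ⟨h, rfl⟩ := φ.surjective h
    rw [sub_mul, trace_sub, htr, ← Units.val_mul, ← Units.val_mul, ← map_mul, hφ, sub_self]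
  have hone : L 1 = 1 := by simpa using hL 1
  have hmul : ∀ A B, L (A * B) = L A * L B := by
    have h1 : LinearMap.compr₂ (LinearMap.mul k _) L =
        LinearMap.compl₁₂ (LinearMap.mul k _) L L := by
      refine linearMap_ext_of_eq_on_GL hk fun g => linearMap_ext_of_eq_on_GL hk fun h => ?_
      simp only [LinearMap.compr₂_apply, LinearMap.mul_apply', LinearMap.compl₁₂_apply, hL]
      rw [← Units.val_mul, hL, map_mul, Units.val_mul]
    exact fun A B => LinearMap.congr_fun (LinearMap.congr_fun h1 A) B
  have hinj : Function.Injective L := by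
    rw [injective_iff_map_eq_zero]
    intro A hA
    refine hzero A fun h => ?_
    rw [← htr, hA, zero_mul, trace_zero]
  exact ⟨AlgEquiv.ofBijective (AlgHom.ofLinearMap L hone hmul)
    ⟨hinj, LinearMap.injective_iff_surjective.1 hinj⟩, hL⟩

/-- Skolem–Noether: the algebra automorphism extending `φ` is conjugation by a linear automorphism
of `kⁿ`. -/
theorem exists_eq_conj_of_trace_eq (hk : (2 : k) ≠ 0) (φ : MulAut (G k n))
    (hφ : ∀ g, (φ g).val.trace = g.val.trace) : ∃ y : G k n, φ = MulAut.conj y := by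
  obtain ⟨L, hL⟩ := exists_algEquiv_of_trace_eq hk φ hφ
  obtain ⟨T, hT⟩ := AlgEquiv.eq_linearEquivConjAlgEquiv
    (((toLinAlgEquiv' (R := k) (n := Fin n)).symm.trans L).trans toLinAlgEquiv')
  let y : G k n := ⟨LinearMap.toMatrix' T.toLinearMap, LinearMap.toMatrix' T.symm.toLinearMap,
    by rw [← LinearMap.toMatrix'_comp]; simp, by rw [← LinearMap.toMatrix'_comp]; simp⟩
  refine ⟨y, MulEquiv.ext fun g => Units.ext ?_⟩
  rw [← hL, MulAut.conj_apply, Units.val_mul, Units.val_mul]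
  have h1 := AlgEquiv.congr_fun hT (toLinAlgEquiv' g.val)
  apply (toLinAlgEquiv' (R := k) (n := Fin n)).injective
  simp only [AlgEquiv.trans_apply, AlgEquiv.symm_apply_apply] at h1
  rw [h1, map_mul, map_mul]
  change _ = toLin' (LinearMap.toMatrix' T.toLinearMap) * _ *
    toLin' (LinearMap.toMatrix' T.symm.toLinearMap)
  rw [toLin'_toMatrix', toLin'_toMatrix']
  rfl

end TracePreserving

/-! ### Conjugations and the transpose inverse as algebraic automorphisms -/

section RegularAutomorphisms

variable {k : Type*} [Field k] {n : ℕ}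

/-- `φ` is an automorphism of the algebraic group `GL_n(k)`. -/
def IsRegularAut (φ : MulAut (G k n)) : Prop :=
  IsVarietyIso (regGL k n) (regGL k n) φ.toEquiv

theorem IsRegularAut.comp_mem {φ : MulAut (G k n)} (hφ : IsRegularAut φ) {f : G k n → k}
    (hf : f ∈ regGL k n) : (fun g => f (φ g)) ∈ regGL k n :=
  (hφ f).1 hf

theorem IsRegularAut.mul {φ ψ : MulAut (G k n)} (hφ : IsRegularAut φ) (hψ : IsRegularAut ψ) :
    IsRegularAut (φ * ψ) :=
  fun f => (hφ f).trans (hψ _)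

theorem isRegularAut_one : IsRegularAut (1 : MulAut (G k n)) := fun _ => Iff.rfl

theorem isRegularAut_of_comp_mem {φ : MulAut (G k n)}
    (h : ∀ f ∈ regGL k n, (fun g => f (φ g)) ∈ regGL k n)
    (h' : ∀ f ∈ regGL k n, (fun g => f (φ⁻¹ g)) ∈ regGL k n) : IsRegularAut φ := by
  refine fun f => ⟨h f, fun hf => ?_⟩
  have := h' _ hf
  simpa using this

theorem IsRegularAut.inv {φ : MulAut (G k n)} (hφ : IsRegularAut φ) : IsRegularAut φ⁻¹ := by
  intro f
  have h := hφ fun g => f (φ⁻¹ g)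
  have h1 : (fun g => f (φ⁻¹ g)) ∘ φ.toEquiv = f := by
    funext g
    exact congrArg f (φ.symm_apply_apply g)
  rw [h1] at h
  exact h.symm

theorem comp_mem_regGL {F : G k n → G k n}
    (h : ∀ i j, (fun g => (F g).val i j) ∈ regGL k n)
    (hd : (fun g => (F g).val.det⁻¹) ∈ regGL k n) {f : G k n → k} (hf : f ∈ regGL k n) :
    (fun g => f (F g)) ∈ regGL k n := by
  induction hf using Algebra.adjoin_induction with
  | mem f hf =>
    rcases hf with ⟨p, rfl⟩ | rfl
    · exact h p.1 p.2
    · exact hd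
  | algebraMap r => exact algebraMap_mem (regGL k n) r
  | add f₁ f₂ _ _ h₁ h₂ => exact add_mem h₁ h₂
  | mul f₁ f₂ _ _ h₁ h₂ => exact mul_mem h₁ h₂

theorem const_mem_regGL (c : k) : (fun _ : G k n => c) ∈ regGL k n :=
  algebraMap_mem (regGL k n) c

theorem sum_mem_regGL {ι : Type*} (s : Finset ι) {F : ι → G k n → k}
    (h : ∀ i ∈ s, F i ∈ regGL k n) : (fun g => ∑ i ∈ s, F i g) ∈ regGL k n := by
  have : (fun g => ∑ i ∈ s, F i g) = ∑ i ∈ s, F i := by funext g; simp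
  rw [this]
  exact sum_mem h

theorem det_mem_regGL {M : G k n → Matrix (Fin n) (Fin n) k}
    (h : ∀ i j, (fun g => M g i j) ∈ regGL k n) : (fun g => (M g).det) ∈ regGL k n := by
  simp only [det_apply']
  refine sum_mem_regGL _ fun σ _ => mul_mem (const_mem_regGL _) ?_
  have : (fun g => ∏ i, M g (σ i) i) = ∏ i, fun g => M g (σ i) i := by funext g; simp
  rw [this]
  exact prod_mem fun i _ => h _ _

theorem isRegularAut_conj (y : G k n) : IsRegularAut (MulAut.conj y) := by
  have key : ∀ (y : G k n), ∀ f ∈ regGL k n, (fun g => f (MulAut.conj y g)) ∈ regGL k n := by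
    intro y f hf
    refine comp_mem_regGL (fun i j => ?_) ?_ hf
    · simp only [MulAut.conj_apply, Units.val_mul, mul_apply]
      exact sum_mem_regGL _ fun a _ => mul_mem (sum_mem_regGL _ fun b _ =>
        mul_mem (const_mem_regGL _) (entry_mem_regGL _ _)) (const_mem_regGL _)
    · have : (fun g : G k n => (MulAut.conj y g).val.det⁻¹) = fun g => g.val.det⁻¹ := by
        funext g
        rw [MulAut.conj_apply, Units.val_mul, Units.val_mul, coe_units_inv, det_conj y.isUnit]
      rw [this]
      exact inv_det_mem_regGL
  refine isRegularAut_of_comp_mem (key y) ?_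
  rw [← map_inv]
  exact key y⁻¹

theorem transposeInverse_val (g : G k n) : (transposeInverse k n g).val = (g⁻¹).valᵀ := rfl

theorem transposeInverse_mul_self : transposeInverse k n * transposeInverse k n = 1 :=
  MulEquiv.ext fun g => (transposeInverse k n).symm_apply_apply g

theorem transposeInverse_inv : (transposeInverse k n)⁻¹ = transposeInverse k n :=
  inv_eq_of_mul_eq_one_left transposeInverse_mul_self

theorem isRegularAut_transposeInverse : IsRegularAut (transposeInverse k n) := by
  have key : ∀ f ∈ regGL k n, (fun g => f (transposeInverse k n g)) ∈ regGL k n := by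
    intro f hf
    refine comp_mem_regGL (fun i j => ?_) ?_ hf
    · have : (fun g : G k n => (transposeInverse k n g).val i j) =
          (fun g => g.val.det⁻¹) * fun g => (g.val.updateRow i (Pi.single j 1)).det := by
        funext g
        rw [transposeInverse_val, transpose_apply, GeneralLinearGroup.coe_inv, inv_def,
          Matrix.smul_apply, adjugate_apply, Ring.inverse_eq_inv', smul_eq_mul, Pi.mul_apply]
      rw [this]
      refine mul_mem inv_det_mem_regGL (det_mem_regGL fun a b => ?_)
      simp only [updateRow_apply]
      split_ifs
      · exact const_mem_regGL _
      · exact entry_mem_regGL _ _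
    · have : (fun g : G k n => (transposeInverse k n g).val.det⁻¹) = fun g => g.val.det := by
        funext g
        rw [transposeInverse_val, det_transpose, GeneralLinearGroup.coe_inv, det_nonsing_inv,
          Ring.inverse_eq_inv', inv_inv]
      rw [this]
      exact det_mem_regGL entry_mem_regGL
  refine isRegularAut_of_comp_mem key ?_
  rw [transposeInverse_inv]
  exact key

theorem transposeInverse_mul_conj (y : G k n) :
    transposeInverse k n * MulAut.conj y =
      MulAut.conj (transposeInverse k n y) * transposeInverse k n := by
  ext1 g
  simp [MulAut.conj_apply]

end RegularAutomorphisms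

/-! ### The diagonal torus, permutation matrices and sign matrices -/

section Diagonal

variable {k : Type*} [Field k] {n : ℕ}

/-- The diagonal torus. -/
def diagGL : (Fin n → kˣ) →* G k n where
  toFun u := ⟨diagonal fun i => (u i : k), diagonal fun i => ((u i)⁻¹ : kˣ),
    by rw [diagonal_mul_diagonal]; simp, by rw [diagonal_mul_diagonal]; simp⟩
  map_one' := Units.ext (by simp)
  map_mul' u v := Units.ext (by simp [diagonal_mul_diagonal])

theorem diagGL_val (u : Fin n → kˣ) : (diagGL u).val = diagonal fun i => (u i : k) := rfl

theorem diagGL_injective : Function.Injective (diagGL : (Fin n → kˣ) → G k n) := by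
  intro u v h
  funext i
  have := congrFun (diagonal_injective (congrArg Units.val h)) i
  exact Units.ext this

theorem commute_diagGL_iff {g : G k n} {u : Fin n → kˣ} :
    Commute g (diagGL u) ↔ ∀ a b, u a ≠ u b → g.val a b = 0 := by
  rw [commute_iff_eq, Units.ext_iff, ← Matrix.ext_iff]
  simp only [Units.val_mul, diagGL_val, mul_diagonal, diagonal_mul]
  refine forall_congr' fun a => forall_congr' fun b => ?_
  rw [mul_comm, ← sub_eq_zero, ← sub_mul, mul_eq_zero, sub_eq_zero, Units.val_inj, eq_comm,
    or_iff_not_imp_left]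

theorem exists_eq_diagGL {g : G k n} {d : Fin n → k} (h : g.val = diagonal d) :
    ∃ u : Fin n → kˣ, g = diagGL u := by
  have hd : ∀ i, d i ≠ 0 := by
    have := GeneralLinearGroup.det_ne_zero g
    rw [h, det_diagonal, Finset.prod_ne_zero_iff] at this
    exact fun i => this i (Finset.mem_univ i)
  exact ⟨fun i => Units.mk0 (d i) (hd i), Units.ext h⟩

theorem transposeInverse_diagGL (u : Fin n → kˣ) :
    transposeInverse k n (diagGL u) = diagGL u⁻¹ := by
  apply Units.ext
  rw [transposeInverse_val, ← map_inv, diagGL_val, diagonal_transpose]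

/-- The permutation matrix of `σ`. -/
def permGL (σ : Equiv.Perm (Fin n)) : G k n :=
  ⟨σ.permMatrix k, σ⁻¹.permMatrix k, by rw [← Matrix.permMatrix_mul]; simp,
    by rw [← Matrix.permMatrix_mul]; simp⟩

theorem permGL_conj_diagGL (σ : Equiv.Perm (Fin n)) (u : Fin n → kˣ) :
    permGL σ * diagGL u * (permGL σ)⁻¹ = diagGL fun i => u (σ i) := by
  rw [mul_inv_eq_iff_eq_mul]
  apply Units.ext
  rw [Units.val_mul, Units.val_mul, diagGL_val, diagGL_val]
  change σ.permMatrix k * _ = _ * σ.permMatrix k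
  ext i j
  rw [mul_diagonal, diagonal_mul]
  by_cases h : σ i = j <;> simp [Equiv.Perm.permMatrix, PEquiv.toMatrix_apply, h]

/-- The diagonal matrix with entries `-1` at the places in `S` and `1` elsewhere. -/
def signGL (k : Type*) [Field k] {n : ℕ} (S : Finset (Fin n)) : G k n :=
  diagGL fun i => if i ∈ S then -1 else 1

theorem signGL_mul_self (S : Finset (Fin n)) : signGL k S * signGL k S = 1 := by
  rw [signGL, ← map_mul, ← map_one diagGL]
  congr 1
  funext i
  by_cases h : i ∈ S <;> simp [h]

theorem signGL_compl (S : Finset (Fin n)) : signGL k Sᶜ = -signGL k S := by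
  apply Units.ext
  rw [Units.val_neg, signGL, signGL, diagGL_val, diagGL_val]
  refine Eq.trans ?_ (diagonal_neg _).symm
  congr 1
  funext i
  by_cases h : i ∈ S <;> simp [h]

theorem neg_one_ne_one_units (hk : (2 : k) ≠ 0) : (-1 : kˣ) ≠ 1 := by
  intro h
  have h1 := congrArg Units.val h
  rw [Units.val_neg, Units.val_one, neg_eq_iff_add_eq_zero, one_add_one_eq_two] at h1
  exact hk h1

theorem signGL_injective (hk : (2 : k) ≠ 0) :
    Function.Injective (signGL k : Finset (Fin n) → G k n) := by
  intro S T h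
  ext i
  have h1 := congrFun (diagGL_injective h) i
  have h2 := neg_one_ne_one_units hk
  by_cases hS : i ∈ S <;> by_cases hT : i ∈ T <;> simp [hS, hT, h2, h2.symm] at h1 ⊢

theorem exists_eq_signGL {g : G k n} {d : Fin n → k} (h : g.val = diagonal d) (hg : g * g = 1) :
    ∃ S, g = signGL k S := by
  classical
  refine ⟨Finset.univ.filter fun i => d i ≠ 1, Units.ext ?_⟩
  rw [h, signGL, diagGL_val]
  congr 1
  funext i
  have h1 := congrArg Units.val hg
  rw [Units.val_mul, h, diagonal_mul_diagonal, Units.val_one, ← diagonal_one] at h1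
  have h2 := congrFun (diagonal_injective h1) i
  rcases mul_self_eq_one_iff.1 h2 with h3 | h3
  · simp [h3]
  · by_cases h4 : d i = 1
    · simp [h4]
    · have h5 : i ∈ Finset.univ.filter fun i => d i ≠ 1 := by simp [h4]
      rw [if_pos h5, h3]
      simp

theorem rank_one_sub_signGL (hk : (2 : k) ≠ 0) (S : Finset (Fin n)) :
    (1 - (signGL k S).val).rank = S.card := by
  classical
  rw [signGL, diagGL_val, ← diagonal_one, diagonal_sub, rank_diagonal]
  rw [Fintype.card_subtype]
  congr 1
  ext i
  have : (1 : k) + 1 ≠ 0 := by rwa [one_add_one_eq_two]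
  by_cases h : i ∈ S <;> simp [h, this]

/-- The rank of `1 - g` is a conjugation invariant that recovers the number of entries `-1`.
Conversely, a permutation matrix carries one set of places to the other. -/
theorem isConj_signGL_iff (hk : (2 : k) ≠ 0) {S T : Finset (Fin n)} :
    IsConj (signGL k S) (signGL k T) ↔ S.card = T.card := by
  classical
  rw [isConj_iff]
  constructor
  · rintro ⟨c, hc⟩
    rw [← rank_one_sub_signGL hk, ← rank_one_sub_signGL hk, ← hc]
    have : (1 - (c * signGL k S * c⁻¹).val) = c.val * (1 - (signGL k S).val) * (c⁻¹).val := by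
      rw [mul_sub, sub_mul, mul_one, Units.mul_inv, Units.val_mul, Units.val_mul]
    rw [this, rank_mul_eq_left_of_isUnit_det, rank_mul_eq_right_of_isUnit_det]
    · exact isUnit_iff_ne_zero.2 (GeneralLinearGroup.det_ne_zero c)
    · exact isUnit_iff_ne_zero.2 (GeneralLinearGroup.det_ne_zero c⁻¹)
  · intro h
    let e : {x // x ∈ T} ≃ {x // x ∈ S} := Finset.equivOfCardEq h.symm
    refine ⟨permGL e.extendSubtype, ?_⟩
    rw [signGL, permGL_conj_diagGL]
    congr 1
    funext i
    have : e.extendSubtype i ∈ S ↔ i ∈ T :=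
      ⟨fun h => by_contra fun h' => e.extendSubtype_not_mem i h' h, e.extendSubtype_mem i⟩
    simp [this]

end Diagonal

/-! ### Simultaneous diagonalization of commuting involutions -/

section SimultaneousDiagonalization

variable {k : Type*} [Field k] [IsAlgClosed k] {n : ℕ}

-- Each `f i` is killed by `X² - 1`, which is separable as `2 ≠ 0`. So generalized eigenspaces are
-- eigenspaces, and the joint decomposition for commuting endomorphisms applies.
open scoped Classical in
theorem isInternal_iInf_eigenspace_of_involutions (hk : (2 : k) ≠ 0) {ι : Type*}
    (f : ι → Module.End k (Fin n → k)) (hcomm : ∀ i j, Commute (f i) (f j))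
    (hsq : ∀ i, f i * f i = 1) :
    DirectSum.IsInternal fun χ : ι → k => ⨅ i, (f i).eigenspace (χ i) := by
  have hss : ∀ i (μ : k), (f i).maxGenEigenspace μ = (f i).eigenspace μ := by
    intro i μ
    refine Module.End.IsFinitelySemisimple.maxGenEigenspace_eq_eigenspace ?_ μ
    refine Module.End.IsSemisimple.isFinitelySemisimple ?_
    refine Module.End.isSemisimple_of_squarefree_aeval_eq_zero (p := X ^ 2 - C 1) ?_ ?_
    · exact (separable_X_pow_sub_C (n := 2) (1 : k) (by exact_mod_cast hk) one_ne_zero).squarefree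
    · simp [sq, hsq]
  have hind := Module.End.independent_iInf_maxGenEigenspace_of_forall_mapsTo f
    fun i j μ => Module.End.mapsTo_maxGenEigenspace_of_comm (hcomm j i) μ
  have htop := Module.End.iSup_iInf_maxGenEigenspace_eq_top_of_iSup_maxGenEigenspace_eq_top_of_commute
    f (fun i j _ => hcomm i j) fun i => Module.End.iSup_maxGenEigenspace_eq_top (f i)
  simp only [hss] at hind htop
  exact DirectSum.isInternal_submodule_of_iSupIndep_of_iSup_eq_top hind htop

/-- Commuting involutions are simultaneously diagonalizable. -/
theorem exists_diagonal_of_commuting_involutions (hk : (2 : k) ≠ 0) {ι : Type*}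
    (A : ι → Matrix (Fin n) (Fin n) k) (hcomm : ∀ i j, A i * A j = A j * A i)
    (hsq : ∀ i, A i * A i = 1) :
    ∃ y : G k n, ∀ i, ∃ d, A i * y.val = y.val * diagonal d := by
  classical
  have hint := isInternal_iInf_eigenspace_of_involutions hk (fun i => toLin' (A i))
    (fun i j => by
      change toLin' (A i) ∘ₗ toLin' (A j) = toLin' (A j) ∘ₗ toLin' (A i)
      rw [← toLin'_mul, hcomm, toLin'_mul])
    (fun i => by
      change toLin' (A i) ∘ₗ toLin' (A i) = LinearMap.id
      rw [← toLin'_mul, hsq, toLin'_one])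
  let b := hint.collectedBasis fun χ => Module.finBasis k _
  have : Fintype (Σ χ : ι → k, Fin (Module.finrank k
    (⨅ i, Module.End.eigenspace (toLin' (A i)) (χ i) : Submodule k (Fin n → k)))) :=
    FiniteDimensional.fintypeBasisIndex b
  have hcard := Module.finrank_eq_card_basis b
  rw [Module.finrank_fin_fun] at hcard
  let e := (Fintype.equivFinOfCardEq hcard.symm).symm
  obtain ⟨y, hy⟩ := exists_mul_eq_mul_diagonal (b.linearIndependent.comp e e.injective)
  refine ⟨y, fun i => ⟨fun j => (e j).1 i, hy _ _ fun j => ?_⟩⟩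
  have hmem := hint.collectedBasis_mem (fun χ => Module.finBasis k _) (e j)
  have := (Submodule.mem_iInf _).1 hmem i
  exact Module.End.mem_eigenspace_iff.1 this

end SimultaneousDiagonalization

/-! ### Automorphisms permute the reflections up to sign -/

section Signs

theorem lt_choose_of_two_le {n q : ℕ} (hq : 2 ≤ q) (hqn : q + 2 ≤ n) : n < n.choose q := by
  induction n generalizing q with
  | zero => omega
  | succ n ih =>
    obtain ⟨q, rfl⟩ : ∃ r, q = r + 1 := ⟨q - 1, by omega⟩
    rw [Nat.choose_succ_succ']
    have h1 : 0 < n.choose (q + 1) := Nat.choose_pos (by omega)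
    have h2 : 0 < n.choose q := Nat.choose_pos (by omega)
    rcases Nat.lt_or_ge n (q + 3) with h | h
    · obtain rfl : n = q + 2 := by omega
      have h3 : (q + 2).choose (q + 1) = q + 2 := Nat.choose_succ_self_right (q + 1)
      rcases Nat.lt_or_ge q 2 with h4 | h4
      · obtain rfl : q = 1 := by omega
        decide
      · have := ih h4 le_rfl
        omega
    · have := ih hq h
      omega

/-- Used to recognize singletons by counting: the sets of size `q` are as numerous as the singletons
only for singletons and their complements. -/
theorem eq_of_choose_eq {n q : ℕ} (hn : 1 ≤ n) (h : n.choose q = n) : q = 1 ∨ q + 1 = n := by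
  by_contra! hc
  rcases Nat.lt_or_ge n q with h1 | h1
  · rw [Nat.choose_eq_zero_of_lt h1] at h; omega
  rcases Nat.eq_zero_or_pos q with rfl | h2
  · simp at h; omega
  rcases Nat.eq_or_lt_of_le h1 with rfl | h3
  · simp at h; omega
  have := lt_choose_of_two_le (n := n) (q := q) (by omega) (by omega)
  omega

/-- A permutation of the subsets of `Fin n` that preserves equality of cardinalities maps the
singletons to the singletons or to their complements. -/
theorem exists_perm_of_card_eq_iff {n : ℕ} (hn : 1 ≤ n) (Φ : Finset (Fin n) → Finset (Fin n))
    (hΦ : Function.Bijective Φ) (hcard : ∀ S T, (Φ S).card = (Φ T).card ↔ S.card = T.card) :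
    ∃ π : Equiv.Perm (Fin n), ∀ i, Φ {i} = {π i} ∨ Φ {i} = {π i}ᶜ := by
  let i₀ : Fin n := ⟨0, hn⟩
  set q := (Φ {i₀}).card with hq
  have hqi : ∀ i, (Φ {i}).card = q := fun i => (hcard _ _).2 (by simp)
  have himg : (Finset.powersetCard 1 Finset.univ).image Φ =
      Finset.powersetCard q (Finset.univ : Finset (Fin n)) := by
    ext T
    obtain ⟨S, rfl⟩ := hΦ.2 T
    rw [Finset.mem_image]
    simp only [Finset.mem_powersetCard, Finset.subset_univ, true_and]
    rw [hq, hcard, Finset.card_singleton]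
    constructor
    · rintro ⟨S', h, h'⟩
      rwa [← hΦ.1 h']
    · exact fun h => ⟨S, h, rfl⟩
  have h1 := congrArg Finset.card himg
  rw [Finset.card_image_of_injective _ hΦ.1, Finset.card_powersetCard, Finset.card_powersetCard,
    Finset.card_univ, Fintype.card_fin, Nat.choose_one_right] at h1
  have key : ∀ Ψ : Finset (Fin n) → Finset (Fin n), Function.Injective Ψ →
      (∀ i, (Ψ {i}).card = 1) → ∃ π : Equiv.Perm (Fin n), ∀ i, Ψ {i} = {π i} := by
    intro Ψ hΨ h
    choose p hp using fun i => Finset.card_eq_one.1 (h i)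
    have hinj : Function.Injective p := fun i j hij => by
      have := hΨ ((hp i).trans (hij ▸ (hp j).symm))
      simpa using this
    exact ⟨Equiv.ofBijective p (Finite.injective_iff_bijective.1 hinj), hp⟩
  rcases eq_of_choose_eq hn h1.symm with h2 | h2
  · obtain ⟨π, hπ⟩ := key Φ hΦ.1 fun i => (hqi i).trans h2
    exact ⟨π, fun i => Or.inl (hπ i)⟩
  · obtain ⟨π, hπ⟩ := key (fun S => (Φ S)ᶜ) (compl_injective.comp hΦ.1) fun i => by
      rw [Finset.card_compl, hqi, Fintype.card_fin]; omega
    exact ⟨π, fun i => Or.inr (by rw [← hπ i, compl_compl])⟩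

variable {k : Type*} [Field k] {n : ℕ}

/-- `φ` permutes the reflections `signGL {i}` by `π`, up to sign. -/
def PermutesReflections (φ : MulAut (G k n)) (π : Equiv.Perm (Fin n)) : Prop :=
  ∀ i, φ (signGL k {i}) = signGL k {π i} ∨ φ (signGL k {i}) = -signGL k {π i}

/-- The image is a central involution, hence a scalar `±1`, and injectivity excludes `1`. -/
theorem map_neg_one_eq (hk : (2 : k) ≠ 0) (φ : MulAut (G k n)) : φ (-1) = -1 := by
  have hc : φ (-1) ∈ Subgroup.center (G k n) := by
    rw [Subgroup.mem_center_iff]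
    intro g
    obtain ⟨g, rfl⟩ := φ.surjective g
    rw [← map_mul, ← map_mul]
    simp
  obtain ⟨c, hc⟩ := GeneralLinearGroup.mem_center_iff_val_mem_range_scalar.1 hc
  have h1 : φ (-1) * φ (-1) = 1 := by rw [← map_mul]; simp
  rcases isEmpty_or_nonempty (Fin n) with he | ⟨⟨i⟩⟩
  · exact Units.ext (Subsingleton.elim _ _)
  have h2 := congrArg Units.val h1
  rw [Units.val_mul, ← hc, ← map_mul, Units.val_one, ← map_one (scalar (Fin n))] at h2
  have h3 : c * c = 1 := by
    have := congrFun (congrFun h2 i) i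
    simpa using this
  rcases mul_self_eq_one_iff.1 h3 with rfl | rfl
  · rw [map_one] at hc
    have h4 : φ (-1) = φ 1 := by rw [map_one]; exact Units.ext hc.symm
    have h5 := congrArg (fun g : G k n => g.val i i) (φ.injective h4)
    simp only [Units.val_neg, Units.val_one, Matrix.neg_apply, one_apply_eq] at h5
    rw [neg_eq_iff_add_eq_zero, one_add_one_eq_two] at h5
    exact absurd h5 hk
  · apply Units.ext
    rw [← hc, map_neg, map_one, Units.val_neg, Units.val_one]

theorem map_neg_eq (hk : (2 : k) ≠ 0) (φ : MulAut (G k n)) (g : G k n) : φ (-g) = -φ g := by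
  rw [← neg_one_mul, map_mul, map_neg_one_eq hk, neg_one_mul]

theorem PermutesReflections.inv (hk : (2 : k) ≠ 0) {φ : MulAut (G k n)}
    {π : Equiv.Perm (Fin n)} (h : PermutesReflections φ π) : PermutesReflections φ⁻¹ π⁻¹ := by
  intro i
  have h1 := h (π⁻¹ i)
  rw [show π (π⁻¹ i) = i from π.apply_symm_apply i] at h1
  rcases h1 with h1 | h1
  · exact Or.inl (φ.symm_apply_eq.2 h1.symm)
  · exact Or.inr (φ.symm_apply_eq.2 (by rw [map_neg_eq hk, h1, neg_neg]))

/-- Up to an inner automorphism, every automorphism of `GL_n(k)` permutes the reflections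
`signGL {i}`, up to sign. -/
theorem exists_permutesReflections [IsAlgClosed k] (hk : (2 : k) ≠ 0) (hn : 1 ≤ n)
    (φ : MulAut (G k n)) :
    ∃ (y : G k n) (π : Equiv.Perm (Fin n)), PermutesReflections ((MulAut.conj y)⁻¹ * φ) π := by
  obtain ⟨y, hy⟩ := exists_diagonal_of_commuting_involutions hk
    (fun S : Finset (Fin n) => (φ (signGL k S)).val)
    (fun S T => by
      rw [← Units.val_mul, ← Units.val_mul, ← map_mul, ← map_mul, signGL, signGL, ← map_mul,
        ← map_mul, mul_comm])
    (fun S => by rw [← Units.val_mul, ← map_mul, signGL_mul_self, map_one, Units.val_one])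
  set ψ := (MulAut.conj y)⁻¹ * φ with hψ
  have hψS : ∀ S, ∃ T, ψ (signGL k S) = signGL k T := by
    intro S
    obtain ⟨d, hd⟩ := hy S
    refine exists_eq_signGL (d := d) ?_ (by rw [← map_mul, signGL_mul_self, map_one])
    rw [hψ, MulAut.mul_apply, MulAut.conj_inv_apply, mul_assoc, Units.val_mul, Units.val_mul, hd,
      ← mul_assoc, Units.inv_mul, one_mul]
  choose Φ hΦ using hψS
  have hinj : Function.Injective Φ := fun S T h => by
    refine signGL_injective hk (ψ.injective ?_)
    rw [hΦ, hΦ, h]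
  -- An automorphism preserves and reflects conjugacy, which for sign matrices means equality of
  -- cardinalities.
  obtain ⟨π, hπ⟩ := exists_perm_of_card_eq_iff hn Φ (Finite.injective_iff_bijective.1 hinj)
    fun S T => by
      rw [← isConj_signGL_iff hk, ← isConj_signGL_iff hk, ← hΦ, ← hΦ]
      constructor
      · intro h
        have := MonoidHom.map_isConj ψ.symm.toMonoidHom h
        simpa using this
      · exact fun h => MonoidHom.map_isConj ψ.toMonoidHom h
  refine ⟨y, π, fun i => ?_⟩
  rw [← hψ, hΦ]
  rcases hπ i with h | h
  · left; rw [h]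
  · right; rw [h, signGL_compl]

end Signs

/-! ### The action on the diagonal torus -/

section Torus

variable {k : Type*} [Field k] {n : ℕ}

/-- An algebraic character of the multiplicative group is a power map. -/
theorem exists_zpow_of_regular_character [IsAlgClosed k] (χ : kˣ →* kˣ)
    (h : ∃ (N : ℕ) (P : k[X]), ∀ x : kˣ, (χ x : k) * (x : k) ^ N = P.eval (x : k)) :
    ∃ m : ℤ, ∀ x, χ x = x ^ m := by
  obtain ⟨N, P, hP⟩ := h
  have hP0 : P ≠ 0 := by
    rintro rfl
    simpa using hP 1
  -- A character has no zero on `kˣ`, so `P` can vanish only at `0` and is a monomial.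
  have hroots : ∀ a ∈ P.roots, a = 0 := by
    intro a ha
    by_contra h0
    have h1 := hP (Units.mk0 a h0)
    rw [Units.val_mk0, (mem_roots'.1 ha).2] at h1
    simp [h0] at h1
  have hPX : P = C P.leadingCoeff * X ^ Multiset.card P.roots := by
    conv_lhs => rw [(IsAlgClosed.splits P).eq_prod_roots]
    congr 1
    rw [Multiset.eq_replicate.2 ⟨rfl, hroots⟩]
    simp
  set r := Multiset.card P.roots
  have hP1 : P.leadingCoeff = 1 := by
    have h1 := hP 1
    rw [hPX] at h1
    simpa using h1.symm
  refine ⟨r - N, fun x => ?_⟩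
  rw [_root_.zpow_sub, eq_mul_inv_iff_mul_eq, zpow_natCast, zpow_natCast]
  apply Units.ext
  rw [Units.val_mul, Units.val_pow_eq_pow_val, hP, hPX, hP1]
  simp

theorem zpow_exponent_injective [Infinite k] {a b : ℤ} (h : ∀ x : kˣ, x ^ a = x ^ b) : a = b := by
  by_contra hab
  have h1 : ∀ x : kˣ, x ^ (a - b).natAbs = 1 := by
    intro x
    have : x ^ (a - b) = 1 := by rw [_root_.zpow_sub, h, mul_inv_cancel]
    rcases Int.natAbs_eq (a - b) with h2 | h2
    · rw [h2, zpow_natCast] at this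
      exact this
    · rw [h2, _root_.zpow_neg, zpow_natCast, inv_eq_one] at this
      exact this
  have hpos : 0 < (a - b).natAbs := Int.natAbs_pos.2 (sub_ne_zero.2 hab)
  have hz : (X : k[X]) * (X ^ (a - b).natAbs - C 1) = 0 := by
    refine Polynomial.funext fun x => ?_
    by_cases hx : x = 0
    · simp [hx]
    · have := congrArg Units.val (h1 (Units.mk0 x hx))
      simp only [Units.val_pow_eq_pow_val, Units.val_mk0, Units.val_one] at this
      simp [this]
  rcases mul_eq_zero.1 hz with h2 | h2
  · exact X_ne_zero h2
  · exact X_pow_sub_C_ne_zero hpos 1 h2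

theorem zpow_sum_eq_prod {ι α : Type*} [CommGroup α] (s : Finset ι) (x : α) (f : ι → ℤ) :
    x ^ ∑ i ∈ s, f i = ∏ i ∈ s, x ^ f i := by
  classical
  induction s using Finset.induction_on with
  | empty => simp
  | insert i s hi ih => rw [Finset.sum_insert hi, Finset.prod_insert hi, _root_.zpow_add, ih]

theorem commute_signGL_iff (hk : (2 : k) ≠ 0) {g : G k n} {i : Fin n} :
    Commute g (signGL k {i}) ↔ ∀ a b, (a = i ∧ b ≠ i ∨ a ≠ i ∧ b = i) → g.val a b = 0 := by
  have h1 := neg_one_ne_one_units hk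
  rw [signGL, commute_diagGL_iff]
  refine forall_congr' fun a => forall_congr' fun b => ?_
  by_cases ha : a = i <;> by_cases hb : b = i <;> simp [ha, hb, h1, h1.symm]

theorem Commute.neg_right_iff {g h : G k n} : Commute g (-h) ↔ Commute g h := by
  rw [commute_iff_eq, commute_iff_eq, mul_neg, neg_mul, neg_inj]

theorem commute_map_iff (φ : MulAut (G k n)) {g h : G k n} :
    Commute (φ g) (φ h) ↔ Commute g h := by
  rw [commute_iff_eq, commute_iff_eq, ← map_mul, ← map_mul, φ.injective.eq_iff]

theorem PermutesReflections.commute_iff {φ : MulAut (G k n)} {π : Equiv.Perm (Fin n)}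
    (h : PermutesReflections φ π) (g : G k n) (i : Fin n) :
    Commute (φ g) (signGL k {π i}) ↔ Commute g (signGL k {i}) := by
  rw [← commute_map_iff φ (g := g)]
  rcases h i with h | h <;> rw [h]
  rw [Commute.neg_right_iff]

/-- A matrix is diagonal exactly when it commutes with all the reflections, and `φ` permutes their
centralizers. -/
theorem PermutesReflections.exists_map_diagGL (hk : (2 : k) ≠ 0) {φ : MulAut (G k n)}
    {π : Equiv.Perm (Fin n)} (h : PermutesReflections φ π) :
    ∃ W : (Fin n → kˣ) →* (Fin n → kˣ), ∀ u, φ (diagGL u) = diagGL (W u) := by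
  have h1 : ∀ u, ∃ w : Fin n → kˣ, φ (diagGL u) = diagGL w := by
    intro u
    refine exists_eq_diagGL (d := fun i => (φ (diagGL u)).val i i) ?_
    ext a b
    by_cases hab : a = b
    · simp [hab]
    · rw [diagonal_apply_ne _ hab]
      have h2 := (h.commute_iff (diagGL u) (π.symm a)).2 (by
        rw [signGL, commute_iff_eq, ← map_mul, ← map_mul, mul_comm])
      rw [π.apply_symm_apply] at h2
      exact (commute_signGL_iff hk).1 h2 a b (Or.inl ⟨rfl, Ne.symm hab⟩)
  choose W hW using h1
  refine ⟨⟨⟨W, ?_⟩, ?_⟩, hW⟩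
  · apply diagGL_injective
    rw [← hW, map_one, map_one]
  · intro u v
    apply diagGL_injective
    rw [← hW, map_mul, map_mul, hW, hW, map_mul]

/-- The image of the one-parameter group `diag(1, …, x, …, 1)` is `diag(y, …, x', …, y)`. -/
theorem PermutesReflections.map_mulSingle_apply_eq (hk : (2 : k) ≠ 0) {φ : MulAut (G k n)}
    {π : Equiv.Perm (Fin n)} (h : PermutesReflections φ π)
    {W : (Fin n → kˣ) →* (Fin n → kˣ)} (hW : ∀ u, φ (diagGL u) = diagGL (W u))
    (i : Fin n) (x : kˣ) {a b : Fin n} (ha : a ≠ π i) (hb : b ≠ π i) :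
    W (Pi.mulSingle i x) a = W (Pi.mulSingle i x) b := by
  by_contra hne
  have hab : a ≠ b := fun h => hne (h ▸ rfl)
  -- If entries `a` and `b` differed, `1 + E_ab` would commute with the reflection at `π i` but not
  -- with the image of the one-parameter group. Yet everything commuting with the reflection at `i`
  -- commutes with that group.
  obtain ⟨g, hg⟩ := exists_val_eq_one_add_single hk a b
  have h1 : Commute g (signGL k {π i}) := by
    rw [commute_signGL_iff hk]
    rintro c d (⟨rfl, hd⟩ | ⟨hc, rfl⟩)
    · rw [hg, Matrix.add_apply, one_apply_ne (Ne.symm hd), single_apply_of_row_ne ha, add_zero]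
    · rw [hg, Matrix.add_apply, one_apply_ne hc, single_apply_of_col_ne _ _ hb, add_zero]
  obtain ⟨g, rfl⟩ := φ.surjective g
  rw [h.commute_iff, commute_signGL_iff hk] at h1
  have h2 : Commute g (diagGL (Pi.mulSingle i x)) := by
    rw [commute_diagGL_iff]
    intro c d hcd
    refine h1 c d ?_
    by_cases hc : c = i <;> by_cases hd : d = i <;> simp_all
  rw [← commute_map_iff φ, hW, commute_diagGL_iff] at h2
  have h3 := h2 a b hne
  rw [hg, Matrix.add_apply, one_apply_ne hab, single_apply_same, zero_add] at h3
  exact one_ne_zero h3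

theorem exists_zpow_of_mulSingle [IsAlgClosed k] {φ : MulAut (G k n)} (hφ : IsRegularAut φ)
    {W : (Fin n → kˣ) →* (Fin n → kˣ)} (hW : ∀ u, φ (diagGL u) = diagGL (W u)) (i j : Fin n) :
    ∃ m : ℤ, ∀ x, W (Pi.mulSingle i x) j = x ^ m := by
  refine exists_zpow_of_regular_character
    ((Pi.evalMonoidHom _ j).comp (W.comp (MonoidHom.mulSingle _ i))) ?_
  obtain ⟨N, P, hP⟩ := exists_eval_of_mem_regGL (hφ.comp_mem (entry_mem_regGL j j))
    (diagonal (Function.update 1 i X))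
  refine ⟨N, P, fun x => ?_⟩
  have hval : (diagGL (Pi.mulSingle i x)).val = diagonal (Function.update 1 i (x : k)) := by
    rw [diagGL_val]
    congr 1
    funext l
    by_cases hl : l = i
    · subst hl; simp
    · simp [hl]
  have h1 := hP x (diagGL (Pi.mulSingle i x)) (by
    rw [hval, diagonal_map (by simp)]
    congr 1
    funext l
    by_cases hl : l = i
    · subst hl; simp
    · simp [hl])
  rw [hW, hval, det_diagonal, Finset.prod_update_of_mem (Finset.mem_univ i)] at h1
  simpa [diagGL_val] using h1

theorem map_const_apply_eq (hk : (2 : k) ≠ 0) {φ : MulAut (G k n)}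
    {W : (Fin n → kˣ) →* (Fin n → kˣ)} (hW : ∀ u, φ (diagGL u) = diagGL (W u)) (z : kˣ)
    (a b : Fin n) : W (fun _ => z) a = W (fun _ => z) b := by
  by_contra hne
  have hab : a ≠ b := fun h => hne (h ▸ rfl)
  obtain ⟨g, hg⟩ := exists_val_eq_one_add_single hk a b
  obtain ⟨g, rfl⟩ := φ.surjective g
  have h2 : Commute g (diagGL fun _ => z) := commute_diagGL_iff.2 fun _ _ h => absurd rfl h
  rw [← commute_map_iff φ, hW, commute_diagGL_iff] at h2
  have h3 := h2 a b hne
  rw [hg, Matrix.add_apply, one_apply_ne hab, single_apply_same, zero_add] at h3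
  exact one_ne_zero h3

/-- The two one-parameter groups are conjugate by a transposition, so their images have equal
determinant. -/
theorem det_map_mulSingle_eq {φ : MulAut (G k n)}
    {W : (Fin n → kˣ) →* (Fin n → kˣ)} (hW : ∀ u, φ (diagGL u) = diagGL (W u)) (x : kˣ)
    (i j : Fin n) : ∏ l, W (Pi.mulSingle i x) l = ∏ l, W (Pi.mulSingle j x) l := by
  have h1 : permGL (Equiv.swap i j) * diagGL (Pi.mulSingle i x) * (permGL (Equiv.swap i j))⁻¹ =
      (diagGL (Pi.mulSingle j x) : G k n) := by
    rw [permGL_conj_diagGL]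
    congr 1
    funext l
    by_cases hl : l = j
    · subst hl; simp
    · have : Equiv.swap i j l ≠ i := fun h => hl (by
        rw [← Equiv.swap_apply_self i j l, h, Equiv.swap_apply_left])
      simp [hl, this]
  have h2 := congrArg (fun g => GeneralLinearGroup.det (φ g)) h1
  simp only [map_mul, map_inv, hW, mul_inv_cancel_comm] at h2
  have h3 := congrArg Units.val h2
  change det _ = det _ at h3
  rw [diagGL_val, diagGL_val, det_diagonal, det_diagonal] at h3
  apply Units.ext
  rw [Units.coe_prod, Units.coe_prod]
  exact h3

/-- The action on the diagonal torus of an algebraic automorphism that permutes the reflections. -/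
theorem PermutesReflections.exists_map_diagGL_eq [IsAlgClosed k] (hk : (2 : k) ≠ 0) (hn : 1 ≤ n)
    {φ : MulAut (G k n)} (hφ : IsRegularAut φ) {π : Equiv.Perm (Fin n)}
    (h : PermutesReflections φ π) :
    ∃ a b : ℤ, ∀ u : Fin n → kˣ,
      φ (diagGL u) = diagGL fun j => (∏ i, u i) ^ b * u (π.symm j) ^ a := by
  have : Infinite k := IsAlgClosed.instInfinite
  obtain ⟨W, hW⟩ := h.exists_map_diagGL hk
  choose m hm using fun i j => exists_zpow_of_mulSingle hφ hW i j
  have hWu : ∀ u j, W u j = ∏ i, u i ^ m i j := by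
    intro u j
    conv_lhs => rw [← Finset.univ_prod_mulSingle u]
    rw [map_prod, Finset.prod_apply]
    exact Finset.prod_congr rfl fun i _ => hm i j (u i)
  have hb : ∀ i, ∃ b, ∀ j, j ≠ π i → m i j = b := by
    intro i
    by_cases he : ∃ j, j ≠ π i
    · obtain ⟨l, hl⟩ := he
      refine ⟨m i l, fun j hj => zpow_exponent_injective (k := k) fun x => ?_⟩
      rw [← hm, ← hm]
      exact h.map_mulSingle_apply_eq hk hW i x hj hl
    -- This case occurs only for `n = 1`, where there is no other entry and any value of `b` would
    -- do.
    · exact ⟨0, fun j hj => absurd ⟨j, hj⟩ he⟩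
  choose b hb using hb
  let a : Fin n → ℤ := fun i => m i (π i) - b i
  have hmab : ∀ i j, m i j = b i + if i = π.symm j then a i else 0 := by
    intro i j
    split_ifs with hij
    · subst hij; simp [a]
    · rw [add_zero]
      refine hb i j fun h => hij ?_
      rw [h, π.symm_apply_apply]
  have hcol : ∀ j, ∑ i, m i j = ∑ i, b i + a (π.symm j) := by
    intro j
    simp [hmab, Finset.sum_add_distrib]
  have hrow : ∀ i, ∑ j, m i j = n * b i + a i := by
    intro i
    simp only [hmab, Finset.sum_add_distrib, Finset.sum_const, Finset.card_univ, Fintype.card_fin,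
      nsmul_eq_mul]
    congr 1
    rw [Finset.sum_eq_single (π i)]
    · simp
    · intro j _ hj
      rw [if_neg]
      rintro rfl
      simp at hj
    · simp
  -- Scalars go to scalars, so the column sums of the exponent matrix agree; this makes `a`
  -- constant. Equal determinants make the row sums agree, which then makes `b` constant.
  have haa : ∀ i j, a i = a j := by
    intro i j
    have h1 : ∑ l, m l (π i) = ∑ l, m l (π j) := zpow_exponent_injective (k := k) fun x => by
      rw [zpow_sum_eq_prod, zpow_sum_eq_prod, ← hWu, ← hWu]
      exact map_const_apply_eq hk hW x _ _
    rw [hcol, hcol, π.symm_apply_apply, π.symm_apply_apply] at h1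
    exact add_left_cancel h1
  have hbb : ∀ i j, b i = b j := by
    intro i j
    have h1 : ∑ l, m i l = ∑ l, m j l := zpow_exponent_injective (k := k) fun x => by
      rw [zpow_sum_eq_prod, zpow_sum_eq_prod]
      simp only [← hm]
      exact det_map_mulSingle_eq hW x i j
    rw [hrow, hrow, haa i j, add_left_inj] at h1
    exact mul_left_cancel₀ (by exact_mod_cast (by omega : n ≠ 0)) h1
  let i₀ : Fin n := ⟨0, hn⟩
  refine ⟨a i₀, b i₀, fun u => ?_⟩
  rw [hW]
  congr 1
  funext j
  rw [hWu, ← Finset.prod_zpow]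
  simp only [hmab, _root_.zpow_add, Finset.prod_mul_distrib]
  congr 1
  · exact Finset.prod_congr rfl fun i _ => by rw [hbb i i₀]
  · rw [Finset.prod_eq_single (π.symm j)]
    · rw [if_pos rfl, haa _ i₀]
    · intro i _ hi
      rw [if_neg hi, zpow_zero]
    · simp

end Torus

/-! ### Classification of algebraic automorphisms -/

section AlgebraicAutomorphisms

variable {k : Type*} [Field k] [IsAlgClosed k] {n : ℕ}

/-- On scalars `φ` is the power `n b + a`; on diagonal matrices of determinant `1` it is the power
`a` up to permutation. Both powers are inverted by `φ⁻¹`. -/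
theorem exponents_mul_eq_one {φ : MulAut (G k n)} {π : Equiv.Perm (Fin n)} {a b a' b' : ℤ}
    (hn : 1 ≤ n)
    (h : ∀ u : Fin n → kˣ, φ (diagGL u) = diagGL fun j => (∏ i, u i) ^ b * u (π.symm j) ^ a)
    (h' : ∀ u : Fin n → kˣ,
      φ⁻¹ (diagGL u) = diagGL fun j => (∏ i, u i) ^ b' * u ((π⁻¹).symm j) ^ a') :
    (n * b + a) * (n * b' + a') = 1 ∧ (2 ≤ n → a * a' = 1) := by
  have : Infinite k := IsAlgClosed.instInfinite
  have key : ∀ (u : Fin n → kˣ) (j : Fin n),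
      u j = ((∏ i, u i) ^ (n * b + a)) ^ b' * ((∏ i, u i) ^ b * u j ^ a) ^ a' := by
    intro u j
    have h1 : φ⁻¹ (φ (diagGL u)) = diagGL u := φ.symm_apply_apply _
    rw [h, h'] at h1
    have h2 := congrFun (diagGL_injective h1) j
    have h3 : π.symm ((π⁻¹).symm j) = j := π.symm_apply_apply j
    simp only [h3] at h2
    rw [Finset.prod_mul_distrib, Finset.prod_const, Finset.card_univ, Fintype.card_fin,
      Finset.prod_zpow, Equiv.prod_comp π.symm u] at h2
    rw [_root_.zpow_add, mul_comm (n : ℤ) b, _root_.zpow_mul, zpow_natCast]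
    exact h2.symm
  constructor
  · refine zpow_exponent_injective (k := k) fun x => ?_
    have h1 := key (fun _ => x) ⟨0, hn⟩
    simp only [Finset.prod_const, Finset.card_univ, Fintype.card_fin] at h1
    rw [zpow_one]
    conv_rhs => rw [h1]
    rw [← zpow_natCast, ← _root_.zpow_mul, ← _root_.zpow_mul, ← _root_.zpow_mul,
      ← _root_.zpow_add, ← _root_.zpow_mul, ← _root_.zpow_add]
    congr 1
    ring
  · intro hn2
    refine zpow_exponent_injective (k := k) fun x => ?_
    let i : Fin n := ⟨0, hn⟩
    let j : Fin n := ⟨1, hn2⟩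
    have hij : i ≠ j := by simp [i, j]
    have h1 := key (Pi.mulSingle i x * Pi.mulSingle j x⁻¹) i
    have h2 : ∏ l, (Pi.mulSingle i x * Pi.mulSingle j x⁻¹ : Fin n → kˣ) l = 1 := by
      simp [Finset.prod_mul_distrib]
    rw [h2] at h1
    simp [hij] at h1
    rw [_root_.zpow_mul, zpow_one]
    exact h1.symm

theorem trace_map_diagGL_eq {k : Type*} [Field k] {n : ℕ} {φ : MulAut (G k n)}
    {π : Equiv.Perm (Fin n)} {a b a' : ℤ} (hn : 1 ≤ n)
    (h : ∀ u : Fin n → kˣ, φ (diagGL u) = diagGL fun j => (∏ i, u i) ^ b * u (π.symm j) ^ a)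
    (hab : n * b + a = 1) (haa : 2 ≤ n → a * a' = 1) (u : Fin n → kˣ) :
    (φ (diagGL u)).val.trace = (diagGL u).val.trace := by
  rw [h, diagGL_val, diagGL_val, trace_diagonal, trace_diagonal,
    Equiv.sum_comp π.symm fun j => (((∏ i, u i) ^ b * u j ^ a : kˣ) : k)]
  rcases Nat.lt_or_ge n 2 with h2 | h2
  · obtain rfl : n = 1 := by omega
    simp only [Fin.sum_univ_one, Fin.prod_univ_one]
    rw [← _root_.zpow_add, show b + a = 1 by simpa using hab, zpow_one]
  rcases Int.eq_one_or_neg_one_of_mul_eq_one (haa h2) with rfl | rfl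
  · have hb : b = 0 := by
      have : (n : ℤ) * b = 0 := by omega
      exact (mul_eq_zero.1 this).resolve_left (by omega)
    simp [hb]
  -- The exceptional case `n = 2`, `a = -1`, `b = 1`: multiplying the inverse entries by the
  -- determinant merely swaps them, so the trace survives. It reflects that `g ↦ det(g) ᵗg⁻¹` is
  -- inner on `GL_2`.
  · have hb : (n : ℤ) * b = 2 := by omega
    have hn2 : n ∣ 2 := by exact_mod_cast Dvd.intro _ hb
    obtain rfl : n = 2 := le_antisymm (Nat.le_of_dvd two_pos hn2) h2
    obtain rfl : b = 1 := by push_cast at hb; omega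
    simp only [Fin.sum_univ_two, Fin.prod_univ_two]
    rw [zpow_one, _root_.zpow_neg, zpow_one, _root_.zpow_neg, zpow_one, mul_inv_cancel_right,
      mul_inv_cancel_comm, add_comm]

/-- The trace is a class function, so equality on the torus gives equality on diagonalizable
matrices, which are dense. -/
theorem trace_eq_of_trace_diagGL_eq {φ : MulAut (G k n)} (hφ : IsRegularAut φ)
    (h : ∀ u : Fin n → kˣ, (φ (diagGL u)).val.trace = (diagGL u).val.trace) (g : G k n) :
    (φ g).val.trace = g.val.trace := by
  rw [← sub_eq_zero]
  refine eq_zero_of_eq_zero_of_diagonalizable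
    (sub_mem (hφ.comp_mem trace_mem_regGL) trace_mem_regGL) (fun g y d hg => ?_) g
  have h1 : (y⁻¹ * g * y).val = diagonal d := by
    rw [Units.val_mul, Units.val_mul, mul_assoc, hg, ← mul_assoc, Units.inv_mul, one_mul]
  obtain ⟨u, hu⟩ := exists_eq_diagGL h1
  have h2 : g = y * diagGL u * y⁻¹ := by rw [← hu]; group
  have h3 : ∀ y z : G k n, (y * z * y⁻¹).val.trace = z.val.trace := fun y z => by
    rw [Units.val_mul, trace_mul_comm, ← Units.val_mul, inv_mul_cancel_left]
  simp only [Pi.sub_apply]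
  rw [sub_eq_zero, h2, map_mul, map_mul, map_inv, h3, h3, h]

theorem PermutesReflections.exists_eq_conj (hk : (2 : k) ≠ 0) (hn : 1 ≤ n)
    {φ : MulAut (G k n)} (hφ : IsRegularAut φ) {π : Equiv.Perm (Fin n)}
    (h : PermutesReflections φ π) :
    ∃ y : G k n, φ = MulAut.conj y ∨ φ = MulAut.conj y * transposeInverse k n := by
  obtain ⟨a, b, hab⟩ := h.exists_map_diagGL_eq hk hn hφ
  obtain ⟨a', b', hab'⟩ := (h.inv hk).exists_map_diagGL_eq hk hn hφ.inv
  obtain ⟨h1, h2⟩ := exponents_mul_eq_one hn hab hab'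
  rcases Int.eq_one_or_neg_one_of_mul_eq_one h1 with h3 | h3
  · obtain ⟨y, hy⟩ := exists_eq_conj_of_trace_eq hk φ
      (trace_eq_of_trace_diagGL_eq hφ (trace_map_diagGL_eq hn hab h3 h2))
    exact ⟨y, Or.inl hy⟩
  -- Composing with the transpose inverse negates both exponents, turning `n b + a = -1` into the
  -- case already treated.
  · have hτ : ∀ u : Fin n → kˣ, (transposeInverse k n * φ) (diagGL u) =
        diagGL fun j => (∏ i, u i) ^ (-b) * u (π.symm j) ^ (-a) := by
      intro u
      rw [MulAut.mul_apply, hab, transposeInverse_diagGL]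
      congr 1
      funext j
      simp [mul_comm]
    obtain ⟨y, hy⟩ := exists_eq_conj_of_trace_eq hk (transposeInverse k n * φ)
      (trace_eq_of_trace_diagGL_eq (isRegularAut_transposeInverse.mul hφ)
        (trace_map_diagGL_eq (a' := -a') hn hτ (by linarith) (by simpa using h2)))
    refine ⟨transposeInverse k n y, Or.inr ?_⟩
    rw [← transposeInverse_mul_conj, ← hy, ← mul_assoc, transposeInverse_mul_self, one_mul]

/-- Every automorphism of the algebraic group `GL_n(k)` is inner or the product of an inner
automorphism with `g ↦ ᵗg⁻¹`. -/
theorem IsRegularAut.exists_eq_conj (hk : (2 : k) ≠ 0) (hn : 1 ≤ n)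
    {φ : MulAut (G k n)} (hφ : IsRegularAut φ) :
    ∃ y : G k n, φ = MulAut.conj y ∨ φ = MulAut.conj y * transposeInverse k n := by
  obtain ⟨z, π, h⟩ := exists_permutesReflections hk hn φ
  obtain ⟨y, hy⟩ := h.exists_eq_conj hk hn ((isRegularAut_conj z).inv.mul hφ)
  refine ⟨z * y, ?_⟩
  rw [map_mul, mul_assoc]
  exact hy.imp inv_mul_eq_iff_eq_mul.1 inv_mul_eq_iff_eq_mul.1

end AlgebraicAutomorphisms

/-! ### Isomorphisms of semidirect products and the inner case -/

theorem c2_eq_of_ne_one {s : C2} (h : s ≠ 1) : s = Multiplicative.ofAdd 1 := by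
  revert s; decide

theorem c2_generator_ne_one : (Multiplicative.ofAdd 1 : C2) ≠ 1 := by decide

theorem c2_generator_mul_self : (Multiplicative.ofAdd 1 : C2) * Multiplicative.ofAdd 1 = 1 := by
  decide

theorem comp_mul_right_mem_regGL {k : Type*} [Field k] {n : ℕ} {f : G k n → k}
    (hf : f ∈ regGL k n) (y : G k n) : (fun g => f (g * y)) ∈ regGL k n := by
  refine comp_mem_regGL (fun i j => ?_) ?_ hf
  · simp only [Units.val_mul, mul_apply]
    exact sum_mem_regGL _ fun b _ => mul_mem (entry_mem_regGL _ _) (const_mem_regGL _)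
  · simp only [Units.val_mul, det_mul, mul_inv]
    exact mul_mem inv_det_mem_regGL (const_mem_regGL _)

namespace Involution

variable {k : Type*} [Field k] {n : ℕ}

section Isomorphisms

theorem iso_of_conj {σ σ' : Involution k n} {φ : MulAut (G k n)} (hφ : IsRegularAut φ)
    (h : σ'.aut = φ * σ.aut * φ⁻¹) : σ.Iso σ' := by
  have h' : ∀ g, φ (σ.aut g) = σ'.aut (φ g) := fun g => by simp [h]
  refine ⟨SemidirectProduct.congr φ (MulEquiv.refl C2) fun s => ?_, fun f => ?_⟩
  · ext1 g
    by_cases hs : s = 1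
    · subst hs; simp
    · rw [c2_eq_of_ne_one hs]
      simp [action_generator, h']
  · exact forall_congr' fun s => hφ fun g => f ⟨g, s⟩

theorem iso_symm {σ σ' : Involution k n} (h : σ.Iso σ') : σ'.Iso σ :=
  (isoSetoid k n).symm h

/-- The homomorphism from `ℤ/2ℤ` that sends the generator to an involution `x`. -/
def homOfSq (x : G k n) (hx : x * x = 1) : C2 →* G k n where
  toFun s := if s = 1 then 1 else x
  map_one' := by simp
  map_mul' s t := by
    by_cases hs : s = 1 <;> by_cases ht : t = 1
    · simp [hs, ht]
    · simp [hs]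
    · simp [ht]
    · rw [c2_eq_of_ne_one hs, c2_eq_of_ne_one ht, c2_generator_mul_self, if_pos rfl,
        if_neg c2_generator_ne_one, hx]

theorem action_eq_conj_homOfSq (σ : Involution k n) (x : G k n) (hx : x * x = 1)
    (h : σ.aut = MulAut.conj x) (s : C2) : σ.action s = MulAut.conj (homOfSq x hx s) := by
  by_cases hs : s = 1
  · subst hs; simp
  · rw [c2_eq_of_ne_one hs, action_generator, h]
    rfl

/-- The isomorphism `(g, s) ↦ (g xˢ, s)` of `GL_n(k) ⋊ ⟨ad x⟩` with `GL_n(k) × ℤ/2ℤ`. -/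
def equivProdOfSq (σ : Involution k n) (x : G k n) (hx : x * x = 1)
    (h : σ.aut = MulAut.conj x) : σ.Semidirect ≃* G k n × C2 where
  toFun p := (p.left * homOfSq x hx p.right, p.right)
  invFun q := ⟨q.1 * (homOfSq x hx q.2)⁻¹, q.2⟩
  left_inv p := by ext <;> simp
  right_inv q := by ext <;> simp
  map_mul' p q := by
    refine Prod.ext ?_ rfl
    change p.left * σ.action p.right q.left * homOfSq x hx (p.right * q.right) =
      p.left * homOfSq x hx p.right * (q.left * homOfSq x hx q.right)
    rw [action_eq_conj_homOfSq σ x hx h, MulAut.conj_apply, map_mul]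
    group

theorem isVarietyIso_equivProdOfSq (σ : Involution k n) (x : G k n) (hx : x * x = 1)
    (h : σ.aut = MulAut.conj x) :
    IsVarietyIso σ.reg (regProd k n) (σ.equivProdOfSq x hx h).toEquiv := by
  intro f
  refine forall_congr' fun s => ⟨fun hf =>
    comp_mul_right_mem_regGL (f := fun g => f (g, s)) hf (homOfSq x hx s), fun hf => ?_⟩
  have h1 := comp_mul_right_mem_regGL hf (homOfSq x hx s)⁻¹
  change (fun g => f (g * (homOfSq x hx s)⁻¹ * homOfSq x hx s, s)) ∈ regGL k n at h1
  simpa using h1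

theorem conj_eq_one_iff {x : G k n} : MulAut.conj x = 1 ↔ ∃ c : k, x.val = c • 1 := by
  have h1 : MulAut.conj x = 1 ↔ x ∈ Subgroup.center (G k n) := by
    rw [Subgroup.mem_center_iff, MulEquiv.ext_iff]
    refine forall_congr' fun g => ?_
    rw [MulAut.conj_apply, MulAut.one_apply, mul_inv_eq_iff_eq_mul, eq_comm]
  rw [h1, GeneralLinearGroup.mem_center_iff_val_mem_range_scalar]
  simp only [Set.mem_range, scalar_apply, smul_one_eq_diagonal, eq_comm]

theorem conj_eq_conj_iff {x y : G k n} :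
    MulAut.conj x = MulAut.conj y ↔ ∃ c : k, x.val = c • y.val := by
  rw [← mul_inv_eq_one, ← map_inv, ← map_mul, conj_eq_one_iff]
  refine exists_congr fun c => ⟨fun h => ?_, fun h => ?_⟩
  · have := congrArg (· * y.val) h
    simpa using this
  · rw [Units.val_mul, h, smul_mul_assoc, Units.mul_inv]

/-- `σ² = 1` makes `x²` a scalar `c`; dividing `x` by a square root of `c` leaves `ad(x)` unchanged.
-/
theorem IsInner.exists_sq [IsAlgClosed k] {σ : Involution k n} (h : σ.IsInner) :
    ∃ x : G k n, x * x = 1 ∧ σ.aut = MulAut.conj x := by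
  rcases isEmpty_or_nonempty (Fin n) with he | ⟨⟨i⟩⟩
  · obtain ⟨x, hx⟩ := h
    exact ⟨x, Units.ext (Subsingleton.elim _ _), hx⟩
  obtain ⟨x, hx⟩ := h
  have h1 := σ.sq
  rw [hx, ← map_mul, conj_eq_one_iff] at h1
  obtain ⟨c, hc⟩ := h1
  have hc0 : c ≠ 0 := by
    rintro rfl
    rw [zero_smul] at hc
    have := GeneralLinearGroup.det_ne_zero (x * x)
    have hne : Nonempty (Fin n) := ⟨i⟩
    rw [hc, det_zero] at this
    exact this rfl
  obtain ⟨d, hd⟩ := IsAlgClosed.exists_pow_nat_eq c (n := 2) (by norm_num)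
  have hd0 : d ≠ 0 := by rintro rfl; exact hc0 (by simpa using hd.symm)
  refine ⟨GeneralLinearGroup.scalar (Fin n) (Units.mk0 d hd0)⁻¹ * x, ?_, ?_⟩
  · have h2 : (GeneralLinearGroup.scalar (Fin n) (Units.mk0 d hd0)⁻¹ * x) *
        (GeneralLinearGroup.scalar (Fin n) (Units.mk0 d hd0)⁻¹ * x) =
        GeneralLinearGroup.scalar (Fin n) ((Units.mk0 d hd0)⁻¹ * (Units.mk0 d hd0)⁻¹) * (x * x) := by
      rw [map_mul, mul_assoc, ← mul_assoc x,
        ← GeneralLinearGroup.scalar_commute, mul_assoc, mul_assoc]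
    rw [h2]
    apply Units.ext
    rw [Units.val_mul, hc, GeneralLinearGroup.coe_scalar, ← hd]
    ext a b
    by_cases hab : a = b <;> simp [hab]
    field_simp
  · rw [hx, conj_eq_conj_iff]
    refine ⟨d, ?_⟩
    rw [Units.val_mul, GeneralLinearGroup.coe_scalar]
    ext a b
    simp [hd0]

theorem IsInner.exists_equivProd [IsAlgClosed k] {σ : Involution k n} (h : σ.IsInner) :
    ∃ e : σ.Semidirect ≃* G k n × C2, IsVarietyIso σ.reg (regProd k n) e.toEquiv := by
  obtain ⟨x, hx, h⟩ := h.exists_sq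
  exact ⟨σ.equivProdOfSq x hx h, σ.isVarietyIso_equivProdOfSq x hx h⟩

theorem IsInner.iso [IsAlgClosed k] {σ σ' : Involution k n} (h : σ.IsInner) (h' : σ'.IsInner) :
    σ.Iso σ' := by
  obtain ⟨e, he⟩ := h.exists_equivProd
  obtain ⟨e', he'⟩ := h'.exists_equivProd
  refine ⟨e.trans e'.symm, fun f => ?_⟩
  have h1 := he' (f ∘ e'.symm)
  have h2 : (f ∘ e'.symm) ∘ e'.toEquiv = f := by
    funext x
    simp
  rw [h2] at h1
  exact h1.symm.trans (he _)

end Isomorphisms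

/-! ### The identity component and what an isomorphism induces on it -/

section IdentityComponent

theorem comp_mem_regGL_of_isVarietyIso {σ σ' : Involution k n} {e : σ.Semidirect ≃* σ'.Semidirect}
    (he : IsVarietyIso σ.reg σ'.reg e.toEquiv) (F : C2 → G k n → k)
    (hF : ∀ s, F s ∈ regGL k n) :
    (fun g => F (e ⟨g, 1⟩).right (e ⟨g, 1⟩).left) ∈ regGL k n :=
  (he fun p => F p.right p.left).1 hF 1

theorem right_eq_one_of_isVarietyIso [Infinite k] {σ σ' : Involution k n}
    {e : σ.Semidirect ≃* σ'.Semidirect} (he : IsVarietyIso σ.reg σ'.reg e.toEquiv) (g : G k n) :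
    (e ⟨g, 1⟩).right = 1 := by
  -- The indicator of the identity coset is regular; its pullback to `GL_n` is idempotent and equals
  -- `1` at the identity.
  have h1 := comp_mem_regGL_of_isVarietyIso he (fun s _ => if s = 1 then 1 else 0)
    fun s => const_mem_regGL _
  have h2 := eq_one_of_idempotent h1 (fun g => by split_ifs <;> simp) (by
    have : e ⟨1, 1⟩ = 1 := map_one e
    rw [this]
    simp) g
  by_contra h3
  rw [if_neg h3] at h2
  exact zero_ne_one h2

/-- An isomorphism of algebraic groups between two semidirect products maps the identity component
`GL_n(k)` to itself. -/
theorem exists_aut_of_iso [Infinite k] {σ σ' : Involution k n} (h : σ.Iso σ') :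
    ∃ (φ : MulAut (G k n)) (x : G k n), IsRegularAut φ ∧
      φ * σ.aut * φ⁻¹ = MulAut.conj x * σ'.aut ∧ x * σ'.aut x = 1 := by
  obtain ⟨e, he⟩ := h
  have he' : IsVarietyIso σ'.reg σ.reg e.symm.toEquiv := by
    intro f
    have h1 := he (f ∘ e.symm)
    have h2 : (f ∘ e.symm) ∘ e.toEquiv = f := by
      funext x
      simp
    rw [h2] at h1
    exact h1.symm
  have hr := right_eq_one_of_isVarietyIso he
  have hr' := right_eq_one_of_isVarietyIso he'
  have hφ : ∀ g, e ⟨g, 1⟩ = ⟨(e ⟨g, 1⟩).left, 1⟩ := fun g => SemidirectProduct.ext rfl (hr g)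
  have hφ' : ∀ g, e.symm ⟨g, 1⟩ = ⟨(e.symm ⟨g, 1⟩).left, 1⟩ := fun g =>
    SemidirectProduct.ext rfl (hr' g)
  let φ : MulAut (G k n) :=
    { toFun := fun g => (e ⟨g, 1⟩).left
      invFun := fun g => (e.symm ⟨g, 1⟩).left
      left_inv := fun g => by
        change (e.symm ⟨(e ⟨g, 1⟩).left, 1⟩).left = g
        rw [← hφ, e.symm_apply_apply]
      right_inv := fun g => by
        change (e ⟨(e.symm ⟨g, 1⟩).left, 1⟩).left = g
        rw [← hφ', e.apply_symm_apply]
      map_mul' := fun g h => by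
        have h1 : (⟨g * h, 1⟩ : σ.Semidirect) = ⟨g, 1⟩ * ⟨h, 1⟩ := by ext <;> simp
        rw [h1, map_mul, SemidirectProduct.mul_left, hr]
        simp }
  have hφe : ∀ g, e ⟨g, 1⟩ = ⟨φ g, 1⟩ := hφ
  set γ : C2 := Multiplicative.ofAdd 1 with hγ
  -- Otherwise `e⁻¹` would send an element of the identity component outside it.
  have hw : (e ⟨1, γ⟩).right = γ := by
    refine c2_eq_of_ne_one fun h1 => ?_
    have h2 := hr' (e ⟨1, γ⟩).left
    have h3 : (⟨(e ⟨1, γ⟩).left, 1⟩ : σ'.Semidirect) = e ⟨1, γ⟩ :=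
      SemidirectProduct.ext rfl h1.symm
    rw [h3, e.symm_apply_apply] at h2
    exact c2_generator_ne_one h2
  set x := (e ⟨1, γ⟩).left with hx
  have hwx : e ⟨1, γ⟩ = ⟨x, γ⟩ := SemidirectProduct.ext rfl hw
  refine ⟨φ, x, isRegularAut_of_comp_mem
    (fun f hf => comp_mem_regGL_of_isVarietyIso he (fun _ => f) fun _ => hf)
    (fun f hf => comp_mem_regGL_of_isVarietyIso he' (fun _ => f) fun _ => hf), ?_, ?_⟩
  -- Both relations are images under `e` of relations satisfied by the generator `γ`: it acts by
  -- `σ`, and `γ² = 1`. Its image is `(x, γ)`.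
  · rw [mul_inv_eq_iff_eq_mul]
    ext1 g
    have h1 : (⟨σ.aut g, 1⟩ : σ.Semidirect) * ⟨1, γ⟩ = ⟨1, γ⟩ * ⟨g, 1⟩ := by
      ext1 <;> simp [hγ, action_generator]
    have h2 := congrArg SemidirectProduct.left (congrArg e h1)
    rw [map_mul, map_mul, hφe, hφe, hwx, SemidirectProduct.mul_left, SemidirectProduct.mul_left,
      map_one, MulAut.one_apply, hγ, action_generator] at h2
    change φ (σ.aut g) = x * σ'.aut (φ g) * x⁻¹
    rw [eq_mul_inv_iff_mul_eq]
    exact h2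
  · have h1 : (⟨1, γ⟩ : σ.Semidirect) * ⟨1, γ⟩ = 1 := by
      ext1 <;> simp [hγ, c2_generator_mul_self]
    have h2 := congrArg SemidirectProduct.left (congrArg e h1)
    rw [map_mul, hwx, SemidirectProduct.mul_left, hγ, action_generator, map_one e] at h2
    exact h2

theorem IsInner.of_iso [Infinite k] {σ σ' : Involution k n} (h : σ.IsInner) (hi : σ.Iso σ') :
    σ'.IsInner := by
  obtain ⟨z, hz⟩ := h
  obtain ⟨φ, x, -, h1, -⟩ := exists_aut_of_iso hi
  have h2 : φ * MulAut.conj z * φ⁻¹ = MulAut.conj (φ z) := by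
    ext1 g
    simp
  rw [hz, h2] at h1
  refine ⟨x⁻¹ * φ z, ?_⟩
  rw [map_mul, map_inv, h1, inv_mul_cancel_left]

end IdentityComponent

end Involution

/-! ### Bilinear forms and their transposition sign -/

section Forms

variable {k : Type*} [Field k] {n : ℕ}

/-- Conjugating the involution of the form `a` by `ad(y)` replaces `a` by the congruent form `y a
ᵗy`, so conjugacy of involutions becomes congruence of forms. -/
theorem conj_mul_conj_mul_transposeInverse (y a : G k n) :
    MulAut.conj y * (MulAut.conj a * transposeInverse k n) * (MulAut.conj y)⁻¹ =
      MulAut.conj (y * a * transposeInverse k n y⁻¹) * transposeInverse k n := by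
  rw [← map_inv, mul_assoc, mul_assoc, transposeInverse_mul_conj, map_mul, map_mul]
  simp only [mul_assoc]

theorem val_congr (y a : G k n) :
    (y * a * transposeInverse k n y⁻¹).val = y.val * a.val * y.valᵀ := by
  rw [Units.val_mul, Units.val_mul, transposeInverse_val, inv_inv]

theorem transpose_congr {a : G k n} {ε : k} (ha : a.valᵀ = ε • a.val) (y : G k n) :
    (y * a * transposeInverse k n y⁻¹).valᵀ =
      ε • (y * a * transposeInverse k n y⁻¹).val := by
  rw [val_congr, transpose_mul, transpose_mul, transpose_transpose, ha, smul_mul_assoc,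
    mul_smul_comm, mul_assoc]

theorem eq_of_transpose_eq_smul (hn : 1 ≤ n) {a : G k n} {ε ε' : k} (h : a.valᵀ = ε • a.val)
    (h' : a.valᵀ = ε' • a.val) : ε = ε' := by
  have h1 := congrArg (· * (a⁻¹).val) (h.symm.trans h')
  simp only [smul_mul_assoc, Units.mul_inv] at h1
  have := congrFun (congrFun h1 ⟨0, hn⟩) ⟨0, hn⟩
  simpa using this

theorem transposeInverse_mul_transpose (a : G k n) :
    (transposeInverse k n a).val * a.valᵀ = 1 := by
  rw [transposeInverse_val, ← transpose_mul, Units.mul_inv, transpose_one]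

theorem transposeInverse_transpose_eq_smul {a : G k n} {ε : k} (ha : a.valᵀ = ε • a.val) :
    (transposeInverse k n a).valᵀ = ε • (transposeInverse k n a).val := by
  have h1 := transposeInverse_mul_transpose a
  rw [transposeInverse_val, transpose_transpose]
  rw [ha, mul_smul_comm, transposeInverse_val] at h1
  have h2 := congrArg (· * (a⁻¹).val) h1
  simpa [mul_assoc] using h2.symm

theorem J0_transpose : (J0 k n).valᵀ = (1 : k) • (J0 k n).val := by
  rw [one_smul]
  ext i j
  have h : i = Fin.rev j ↔ j = Fin.rev i := by rw [← Fin.rev_inj, Fin.rev_rev, eq_comm]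
  simp [J0, J0Matrix, h]

theorem J_transpose (hn : Even n) : (J k n).valᵀ = (-1 : k) • (J k n).val := by
  have h1 : (J k n).val = tMatrix k n * J0Matrix k n := rfl
  rw [h1]
  ext i j
  rw [transpose_apply, Matrix.smul_apply, tMatrix, diagonal_mul, diagonal_mul]
  simp only [J0Matrix, of_apply]
  by_cases hij : j = Fin.rev i
  · subst hij
    obtain ⟨m, rfl⟩ := hn
    have h2 : (m + m) / 2 = m := by omega
    have h3 : (Fin.rev i : ℕ) < m ↔ ¬ (i : ℕ) < m := by
      rw [Fin.val_rev]; omega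
    by_cases h4 : (i : ℕ) < m <;> simp [-Fin.val_rev, h2, h3, h4]
  · have : i ≠ Fin.rev j := fun h => hij (by rw [h, Fin.rev_rev])
    simp [hij, this]

theorem not_transpose_eq_neg_of_odd (hk : (2 : k) ≠ 0) (hn : Odd n) (a : G k n) :
    a.valᵀ ≠ (-1 : k) • a.val := by
  intro h
  have h1 := congrArg det h
  rw [det_transpose, det_smul, Fintype.card_fin, hn.neg_one_pow, neg_one_mul,
    eq_neg_iff_add_eq_zero, ← two_mul] at h1
  exact mul_ne_zero hk (GeneralLinearGroup.det_ne_zero a) h1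

end Forms

/-! ### The sign as a complete invariant of outer involutions -/

namespace Involution

variable {k : Type*} [Field k] {n : ℕ}

/-- `σ` is the adjoint involution `g ↦ a ᵗg⁻¹ a⁻¹` of a bilinear form `a` with `ᵗa = ε a`. -/
def HasSign (σ : Involution k n) (ε : k) : Prop :=
  ∃ a : G k n, σ.aut = MulAut.conj a * transposeInverse k n ∧ a.valᵀ = ε • a.val

theorem conj_mul_transposeInverse_sq (a : G k n) :
    MulAut.conj a * transposeInverse k n * (MulAut.conj a * transposeInverse k n) =
      MulAut.conj (a * transposeInverse k n a) := by
  rw [mul_assoc, ← mul_assoc (transposeInverse k n), transposeInverse_mul_conj, mul_assoc,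
    transposeInverse_mul_self, mul_one, map_mul]

theorem exists_hasSign {a : G k n} {ε : k} (ha : a.valᵀ = ε • a.val) (hε : ε * ε = 1) :
    ∃ σ : Involution k n, σ.aut = MulAut.conj a * transposeInverse k n ∧ σ.HasSign ε := by
  refine ⟨⟨MulAut.conj a * transposeInverse k n,
    (isRegularAut_conj a).mul isRegularAut_transposeInverse, ?_⟩, rfl, a, rfl, ha⟩
  rw [conj_mul_transposeInverse_sq, conj_eq_one_iff]
  refine ⟨ε, ?_⟩
  have h1 : a.val = ε • a.valᵀ := by rw [ha, smul_smul, hε, one_smul]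
  have h2 : a.valᵀ * (transposeInverse k n a).val = 1 :=
    mul_eq_one_comm.1 (transposeInverse_mul_transpose a)
  rw [Units.val_mul, h1, smul_mul_assoc, h2]

theorem IsOuter.hasSign [IsAlgClosed k] (hk : (2 : k) ≠ 0) (hn : 1 ≤ n) {σ : Involution k n}
    (h : σ.IsOuter) : σ.HasSign 1 ∨ σ.HasSign (-1) := by
  obtain ⟨a, ha | ha⟩ := IsRegularAut.exists_eq_conj hk hn (φ := σ.aut) σ.algebraic
  · exact absurd ⟨a, ha⟩ h
  have h1 := σ.sq
  rw [ha, conj_mul_transposeInverse_sq, conj_eq_one_iff] at h1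
  obtain ⟨c, hc⟩ := h1
  have h2 : a.val = c • a.valᵀ := by
    have := congrArg (· * a.valᵀ) hc
    rwa [Units.val_mul, mul_assoc, transposeInverse_mul_transpose, mul_one, smul_mul_assoc,
      one_mul] at this
  have h3 : a.valᵀ = c • a.val := by
    have := congrArg transpose h2
    rwa [transpose_smul, transpose_transpose] at this
  -- From `a = c ᵗa` and `ᵗa = c a` follows `c³ = c`, hence `c = ±1`.
  have h4 : a.valᵀ = (c * c * c) • a.val := by
    rw [mul_smul, ← h3, mul_smul, ← h2, ← h3]
  have hc0 : c ≠ 0 := by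
    rintro rfl
    have h5 := GeneralLinearGroup.det_ne_zero a
    have hne : Nonempty (Fin n) := ⟨⟨0, hn⟩⟩
    rw [h2, zero_smul, det_zero] at h5
    exact h5 rfl
  have h5 : c * c = 1 := by
    have h6 := eq_of_transpose_eq_smul hn h3 h4
    exact mul_right_cancel₀ hc0 (by rw [← h6, one_mul])
  rcases mul_self_eq_one_iff.1 h5 with rfl | rfl
  · exact Or.inl ⟨a, ha, h3⟩
  · exact Or.inr ⟨a, ha, h3⟩

theorem HasSign.isOuter [Infinite k] (hn : 1 ≤ n) {σ : Involution k n} {ε : k}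
    (h : σ.HasSign ε) : σ.IsOuter := by
  rintro ⟨y, hy⟩
  obtain ⟨a, ha, -⟩ := h
  have hconj : ∀ (y : G k n) (z : kˣ), MulAut.conj y (diagGL fun _ => z) = diagGL fun _ => z := by
    intro y z
    have : Commute y (diagGL fun _ => z) := commute_diagGL_iff.2 fun _ _ h => absurd rfl h
    rw [MulAut.conj_apply, this.eq, mul_inv_cancel_right]
  -- Conjugations fix scalars and the transpose inverse inverts them; `z = z⁻¹` cannot hold on the
  -- infinite group `kˣ`.
  have h1 : (1 : ℤ) = -1 := zpow_exponent_injective (k := k) fun z => by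
    have h2 := DFunLike.congr_fun (ha.symm.trans hy) (diagGL fun _ => z)
    rw [MulAut.mul_apply, transposeInverse_diagGL, hconj y z] at h2
    have h3 := hconj a z⁻¹
    rw [show (fun _ : Fin n => z⁻¹) = (fun _ => z)⁻¹ from rfl, h2] at h3
    have h4 := congrFun (diagGL_injective h3) ⟨0, hn⟩
    simpa using h4
  omega

/-- The sign is an invariant of the semidirect product. -/
theorem HasSign.eq_of_iso [IsAlgClosed k] (hk : (2 : k) ≠ 0) (hn : 1 ≤ n) {σ σ' : Involution k n}
    {ε ε' : k} (h : σ.HasSign ε) (h' : σ'.HasSign ε') (hi : σ.Iso σ') : ε = ε' := by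
  have : Infinite k := IsAlgClosed.instInfinite
  obtain ⟨a, ha, hae⟩ := h
  obtain ⟨b, hb, hbe⟩ := h'
  obtain ⟨φ, x, hφ, h1, h2⟩ := exists_aut_of_iso hi
  -- Transport by any algebraic automorphism preserves the sign: `ad(y)` gives a congruent form, and
  -- the transpose inverse replaces `a` by `ᵗa⁻¹`.
  obtain ⟨a', ha', hae'⟩ : ∃ a' : G k n, φ * σ.aut * φ⁻¹ = MulAut.conj a' * transposeInverse k n ∧
      a'.valᵀ = ε • a'.val := by
    obtain ⟨y, rfl | rfl⟩ := hφ.exists_eq_conj hk hn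
    · exact ⟨_, by rw [ha, conj_mul_conj_mul_transposeInverse], transpose_congr hae y⟩
    · refine ⟨_, ?_, transpose_congr (transposeInverse_transpose_eq_smul hae) y⟩
      rw [← conj_mul_conj_mul_transposeInverse, ha, _root_.mul_inv_rev, transposeInverse_inv,
        ← transposeInverse_mul_conj]
      simp only [mul_assoc]
      rw [← mul_assoc (transposeInverse k n) (transposeInverse k n), transposeInverse_mul_self,
        one_mul]
  have h3 : MulAut.conj (x * b) = MulAut.conj a' := by
    rw [ha', hb, ← mul_assoc, ← map_mul] at h1
    exact (mul_right_cancel h1).symm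
  obtain ⟨c, hc⟩ := conj_eq_conj_iff.1 h3
  have h4 : (x * b).valᵀ = ε • (x * b).val := by
    rw [hc, transpose_smul, hae', smul_comm]
  -- This is `x σ'(x) = 1` rewritten. Transposing gives `ᵗ(x b) = ε' x b`, while `x b` is a multiple
  -- of `a'` and so has sign `ε`.
  have h5 : (x * b).val = b.val * x.valᵀ := by
    have h6 : x * b = b * transposeInverse k n x⁻¹ := by
      rw [hb, MulAut.mul_apply, MulAut.conj_apply] at h2
      rw [map_inv, eq_mul_inv_iff_mul_eq, ← mul_inv_eq_one, ← h2]
      simp only [mul_assoc]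
    rw [h6, Units.val_mul, transposeInverse_val, inv_inv]
  refine eq_of_transpose_eq_smul hn h4 ?_
  rw [h5, transpose_mul, transpose_transpose, hbe, mul_smul_comm, ← Units.val_mul, h5]

theorem HasSign.iso [IsAlgClosed k] (hk : (2 : k) ≠ 0) {σ σ' : Involution k n}
    {ε : k} (hε : ε ≠ 0) (h : σ.HasSign ε) (h' : σ'.HasSign ε) : σ.Iso σ' := by
  obtain ⟨a, ha, hae⟩ := h
  obtain ⟨b, hb, hbe⟩ := h'
  obtain ⟨y, hy⟩ := exists_mul_mul_transpose_eq hk hε a b hae hbe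
  refine iso_of_conj (isRegularAut_conj y) ?_
  rw [ha, hb, conj_mul_conj_mul_transposeInverse]
  congr 2
  apply Units.ext
  rw [val_congr, hy]

theorem hasSign_iff_exists_conj [IsAlgClosed k] (hk : (2 : k) ≠ 0) {σ : Involution k n} {j : G k n}
    {ε : k} (hε : ε ≠ 0) (hj : j.valᵀ = ε • j.val) :
    σ.HasSign ε ↔ ∃ y : G k n, σ.aut =
      MulAut.conj y * (MulAut.conj j * transposeInverse k n) * (MulAut.conj y)⁻¹ := by
  constructor
  · rintro ⟨a, ha, hae⟩
    obtain ⟨y, hy⟩ := exists_mul_mul_transpose_eq hk hε j a hj hae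
    refine ⟨y, ?_⟩
    rw [ha, conj_mul_conj_mul_transposeInverse]
    congr 2
    apply Units.ext
    rw [val_congr, hy]
  · rintro ⟨y, hy⟩
    exact ⟨_, by rw [hy, conj_mul_conj_mul_transposeInverse], transpose_congr hj y⟩

theorem isOrthogonalType_iff [IsAlgClosed k] (hk : (2 : k) ≠ 0) {σ : Involution k n} :
    σ.IsOrthogonalType ↔ σ.HasSign 1 :=
  (hasSign_iff_exists_conj hk one_ne_zero J0_transpose).symm

theorem isSymplecticType_iff [IsAlgClosed k] (hk : (2 : k) ≠ 0) (hn : Even n)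
    {σ : Involution k n} : σ.IsSymplecticType ↔ σ.HasSign (-1) :=
  (hasSign_iff_exists_conj hk (neg_ne_zero.2 one_ne_zero) (J_transpose hn)).symm

theorem IsInner.setOf_iso_eq [IsAlgClosed k] {σ : Involution k n} (h : σ.IsInner) :
    {σ' | (isoSetoid k n) σ' σ} = {σ' | σ'.IsInner} := by
  have : Infinite k := IsAlgClosed.instInfinite
  ext σ'
  exact ⟨fun hi => h.of_iso (iso_symm hi), fun h' => h'.iso h⟩

theorem HasSign.setOf_iso_eq [IsAlgClosed k] (hk : (2 : k) ≠ 0) (hn : 1 ≤ n)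
    {σ : Involution k n} {ε : k} (hε : ε ≠ 0) (h : σ.HasSign ε) :
    {σ' | (isoSetoid k n) σ' σ} = {σ' | σ'.HasSign ε} := by
  have : Infinite k := IsAlgClosed.instInfinite
  ext σ'
  refine ⟨fun hi => ?_, fun h' => h'.iso hk hε h⟩
  have ho : σ'.IsOuter := fun hin => h.isOuter hn (hin.of_iso hi)
  rcases ho.hasSign hk hn with h1 | h1
  · exact h1.eq_of_iso hk hn h hi ▸ h1
  · exact h1.eq_of_iso hk hn h hi ▸ h1

/-- The identity involution. -/
def refl (k : Type*) [Field k] (n : ℕ) : Involution k n := ⟨1, isRegularAut_one, one_mul 1⟩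

theorem refl_isInner : (refl k n).IsInner := ⟨1, (map_one _).symm⟩

theorem exists_hasSign_one : ∃ σ : Involution k n, σ.HasSign 1 :=
  (exists_hasSign J0_transpose (one_mul 1)).imp fun _ h => h.2

theorem exists_hasSign_neg_one (hn : Even n) : ∃ σ : Involution k n, σ.HasSign (-1) :=
  (exists_hasSign (J_transpose hn) (by ring)).imp fun _ h => h.2

theorem classes_of_even [IsAlgClosed k] (hk : (2 : k) ≠ 0) (hn : 1 ≤ n) (he : Even n) :
    (isoSetoid k n).classes =
      {{σ | σ.IsInner}, {σ | σ.HasSign (-1)}, {σ | σ.HasSign 1}} := by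
  have h1 : (1 : k) ≠ 0 := one_ne_zero
  have h2 : (-1 : k) ≠ 0 := neg_ne_zero.2 h1
  ext s
  simp only [Set.mem_insert_iff, Set.mem_singleton_iff]
  constructor
  · rintro ⟨σ, rfl⟩
    by_cases hi : σ.IsInner
    · exact Or.inl hi.setOf_iso_eq
    · rcases IsOuter.hasSign hk hn hi with h | h
      · exact Or.inr (Or.inr (h.setOf_iso_eq hk hn h1))
      · exact Or.inr (Or.inl (h.setOf_iso_eq hk hn h2))
  · rintro (rfl | rfl | rfl)
    · exact ⟨_, refl_isInner.setOf_iso_eq.symm⟩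
    · obtain ⟨σ, h⟩ := exists_hasSign_neg_one (k := k) he
      exact ⟨σ, (h.setOf_iso_eq hk hn h2).symm⟩
    · obtain ⟨σ, h⟩ := exists_hasSign_one (k := k) (n := n)
      exact ⟨σ, (h.setOf_iso_eq hk hn h1).symm⟩

theorem isOuter_iff_hasSign_one_of_odd [IsAlgClosed k] (hk : (2 : k) ≠ 0) (hn : Odd n)
    {σ : Involution k n} : σ.IsOuter ↔ σ.HasSign 1 := by
  have : Infinite k := IsAlgClosed.instInfinite
  refine ⟨fun h => (h.hasSign hk hn.pos).resolve_right ?_, fun h => h.isOuter hn.pos⟩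
  rintro ⟨a, -, ha⟩
  exact not_transpose_eq_neg_of_odd hk hn a ha

theorem classes_of_odd [IsAlgClosed k] (hk : (2 : k) ≠ 0) (hn : Odd n) :
    (isoSetoid k n).classes = {{σ | σ.IsInner}, {σ | σ.HasSign 1}} := by
  ext s
  simp only [Set.mem_insert_iff, Set.mem_singleton_iff]
  constructor
  · rintro ⟨σ, rfl⟩
    by_cases hi : σ.IsInner
    · exact Or.inl hi.setOf_iso_eq
    · exact Or.inr (((isOuter_iff_hasSign_one_of_odd hk hn).1 hi).setOf_iso_eq hk hn.pos
        one_ne_zero)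
  · rintro (rfl | rfl)
    · exact ⟨_, refl_isInner.setOf_iso_eq.symm⟩
    · obtain ⟨σ, h⟩ := exists_hasSign_one (k := k) (n := n)
      exact ⟨σ, (h.setOf_iso_eq hk hn.pos one_ne_zero).symm⟩

theorem setOf_isInner_ne [Infinite k] (hn : 1 ≤ n) (ε : k) :
    {σ : Involution k n | σ.IsInner} ≠ {σ | σ.HasSign ε} := by
  intro h
  have h1 : refl k n ∈ {σ : Involution k n | σ.HasSign ε} := h ▸ refl_isInner
  exact h1.isOuter hn refl_isInner

theorem setOf_hasSign_ne [IsAlgClosed k] (hk : (2 : k) ≠ 0) (hn : 1 ≤ n) :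
    {σ : Involution k n | σ.HasSign (-1)} ≠ {σ | σ.HasSign 1} := by
  intro h
  obtain ⟨σ, hσ⟩ := exists_hasSign_one (k := k) (n := n)
  have h1 : σ ∈ {σ : Involution k n | σ.HasSign (-1)} := h ▸ hσ
  have h2 := HasSign.eq_of_iso hk hn hσ h1 ((isoSetoid k n).refl σ)
  rw [eq_neg_iff_add_eq_zero, one_add_one_eq_two] at h2
  exact hk h2

end Involution

end GLSemidirect

theorem mainTheorem9 (k : Type*) [Field k] [IsAlgClosed k] (hk : (2 : k) ≠ 0)
    (n : ℕ) (hn : 1 ≤ n) :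
    (∀ σ : GLSemidirect.Involution k n, σ.IsInner →
      ∃ e : σ.Semidirect ≃* GLSemidirect.G k n × GLSemidirect.C2,
        GLSemidirect.IsVarietyIso σ.reg (GLSemidirect.regProd k n) e.toEquiv) ∧
    (Even n →
      (GLSemidirect.isoSetoid k n).classes =
          {{σ | σ.IsInner}, {σ | σ.IsOuter ∧ σ.IsSymplecticType},
            {σ | σ.IsOuter ∧ σ.IsOrthogonalType}} ∧
        (GLSemidirect.isoSetoid k n).classes.ncard = 3) ∧
    (Odd n →
      (GLSemidirect.isoSetoid k n).classes = {{σ | σ.IsInner}, {σ | σ.IsOuter}} ∧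
        (GLSemidirect.isoSetoid k n).classes.ncard = 2) := by
  have : Infinite k := IsAlgClosed.instInfinite
  refine ⟨fun σ h => h.exists_equivProd, fun he => ⟨?_, ?_⟩, fun ho => ⟨?_, ?_⟩⟩
  · rw [GLSemidirect.Involution.classes_of_even hk hn he]
    simp only [GLSemidirect.Involution.isSymplecticType_iff hk he,
      GLSemidirect.Involution.isOrthogonalType_iff hk]
    have hO : ∀ ε : k, {σ : GLSemidirect.Involution k n | σ.IsOuter ∧ σ.HasSign ε} =
        {σ | σ.HasSign ε} := fun ε => Set.ext fun σ => ⟨And.right, fun h => ⟨h.isOuter hn, h⟩⟩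
    rw [hO, hO]
  · rw [GLSemidirect.Involution.classes_of_even hk hn he, Set.ncard_eq_three]
    exact ⟨_, _, _, GLSemidirect.Involution.setOf_isInner_ne hn _,
      GLSemidirect.Involution.setOf_isInner_ne hn _,
      GLSemidirect.Involution.setOf_hasSign_ne hk hn, rfl⟩
  · simp only [GLSemidirect.Involution.classes_of_odd hk ho,
      GLSemidirect.Involution.isOuter_iff_hasSign_one_of_odd hk ho]
  · rw [GLSemidirect.Involution.classes_of_odd hk ho, Set.ncard_eq_two]
    exact ⟨_, _, GLSemidirect.Involution.setOf_isInner_ne hn _, rfl⟩
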